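/- Write $(a;b)_n=\prod_{j=0}^{n-1}(1-ab^j)$ and $(a)_n=(a;q)_n$, and consider the following series in the ring $\mathbb{Z}[[q]]$ of formal power series: $$f_1(q)=\sum_{n\ge 0}\frac{q^{\frac{n^2+n}{2}}(q)_{2n}}{(-q)_n(q)_{2n+1}},\qquad f_2(q)=\sum_{n\ge 1}\frac{q^{\frac{n^2+n}{2}}(q)_{2n-2}}{(-q)_{n-1}(q)_{2n-1}},$$ $$f_3(q)=\sum_{n\ge 0}\frac{(q)_{2n}}{(-q)_{2n+1}}q^n,\qquad f_4(q)=\sum_{n\ge 0}\frac{(q)_{2n+1}}{(-q)_{2n+2}}q^{n+1},$$ $$f_5(q)=\sum_{n\ge 0}(-1)^n\frac{(q)_n}{(q;q^2)_{n+1}}q^{\frac{n^2+n}{2}},\qquad f_6(q)=\sum_{n\ge 1}(-1)^n\frac{(q)_{n-1}(q^2;q^2)_{n-1}}{(q)_{2n-1}}q^n,$$ $$f_7(q)=\sum_{n\ge 0}(-1)^n\frac{q^{n^2+n}(q^2;q^2)_n}{(-q)_{2n+1}},\qquad f_8(q)=\sum_{n\ge 1}\frac{(q)_{2n-1}}{(q^{2n};q^2)_n}q^n.$$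 Each of these series converges coefficientwise in $\mathbb{Z}[[q]]$, and for every $i\in\{1,\dots,8\}$ the series $f_i$ is lacunary, i.e. almost all of its coefficients vanish: if $a_{f_i}(n)$ denotes the $n$-th coefficient of $f_i$, then $$\lim_{N\to\infty}\frac{\#\{0\le n<N : a_{f_i}(n)=0\}}{N}=1.$$ -/

import Mathlib

open scoped PowerSeries PowerSeries.WithPiTopology

namespace QHyper

noncomputable section

/-- The variable `q` of the ring `ℤ⟦q⟧` of formal power series with integer coefficients. -/
abbrev q : ℤ⟦X⟧ := PowerSeries.X

/-- The `q`-Pochhammer symbol with base `b`: `(a; b)_n = ∏_{j=0}^{n-1} (1 - a b^j)`. -/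
def qPoch (a b : ℤ⟦X⟧) (n : ℕ) : ℤ⟦X⟧ :=
  ∏ j ∈ Finset.range n, (1 - a * b ^ j)

theorem constantCoeff_qPoch {a : ℤ⟦X⟧} (b : ℤ⟦X⟧) (n : ℕ)
    (ha : PowerSeries.constantCoeff a = 0) :
    PowerSeries.constantCoeff (qPoch a b n) = 1 := by
  simp [qPoch, map_prod, ha]

/-- The quotient `u / v` of formal power series over `ℤ`, for `v` with constant coefficient `1`. -/
def frac (u v : ℤ⟦X⟧) : ℤ⟦X⟧ :=
  u * PowerSeries.invOfUnit v 1

theorem frac_mul {v : ℤ⟦X⟧} (u : ℤ⟦X⟧) (hv : PowerSeries.constantCoeff v = 1) :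
    frac u v * v = u := by
  rw [frac, mul_assoc, mul_comm (PowerSeries.invOfUnit v 1),
    PowerSeries.mul_invOfUnit v 1 (by simpa using hv), mul_one]

/-- `q^{(n²+n)/2} (q)_{2n} / ((-q)_n (q)_{2n+1})`. -/
def term1 (n : ℕ) : ℤ⟦X⟧ :=
  frac (q ^ ((n ^ 2 + n) / 2) * qPoch q q (2 * n)) (qPoch (-q) q n * qPoch q q (2 * n + 1))

/-- `q^{(n²+n)/2} (q)_{2n-2} / ((-q)_{n-1} (q)_{2n-1})`, used for `n ≥ 1`. -/
def term2 (n : ℕ) : ℤ⟦X⟧ :=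
  frac (q ^ ((n ^ 2 + n) / 2) * qPoch q q (2 * n - 2))
    (qPoch (-q) q (n - 1) * qPoch q q (2 * n - 1))

/-- `(q)_{2n} / (-q)_{2n+1} q^n`. -/
def term3 (n : ℕ) : ℤ⟦X⟧ :=
  frac (qPoch q q (2 * n)) (qPoch (-q) q (2 * n + 1)) * q ^ n

/-- `(q)_{2n+1} / (-q)_{2n+2} q^{n+1}`. -/
def term4 (n : ℕ) : ℤ⟦X⟧ :=
  frac (qPoch q q (2 * n + 1)) (qPoch (-q) q (2 * n + 2)) * q ^ (n + 1)

/-- `(-1)^n (q)_n / (q;q²)_{n+1} q^{(n²+n)/2}`. -/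
def term5 (n : ℕ) : ℤ⟦X⟧ :=
  (-1) ^ n * frac (qPoch q q n) (qPoch q (q ^ 2) (n + 1)) * q ^ ((n ^ 2 + n) / 2)

/-- `(-1)^n (q)_{n-1} (q²;q²)_{n-1} / (q)_{2n-1} q^n`, used for `n ≥ 1`. -/
def term6 (n : ℕ) : ℤ⟦X⟧ :=
  (-1) ^ n * frac (qPoch q q (n - 1) * qPoch (q ^ 2) (q ^ 2) (n - 1)) (qPoch q q (2 * n - 1)) *
    q ^ n

/-- `(-1)^n q^{n²+n} (q²;q²)_n / (-q)_{2n+1}`. -/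
def term7 (n : ℕ) : ℤ⟦X⟧ :=
  (-1) ^ n * frac (q ^ (n ^ 2 + n) * qPoch (q ^ 2) (q ^ 2) n) (qPoch (-q) q (2 * n + 1))

/-- `(q)_{2n-1} / (q^{2n};q²)_n q^n`, used for `n ≥ 1`. -/
def term8 (n : ℕ) : ℤ⟦X⟧ :=
  frac (qPoch q q (2 * n - 1)) (qPoch (q ^ (2 * n)) (q ^ 2) n) * q ^ n

/-- The summands of the eight series, each indexed by `n = 0, 1, 2, …`. The entry with index
`i : Fin 8` belongs to `f_{i+1}`. The series `f_2`, `f_6`, `f_8` are sums over `n ≥ 1`, so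
their summands are shifted by one. -/
def summand : Fin 8 → ℕ → ℤ⟦X⟧ :=
  ![fun n => term1 n, fun n => term2 (n + 1), fun n => term3 n, fun n => term4 n,
    fun n => term5 n, fun n => term6 (n + 1), fun n => term7 n, fun n => term8 (n + 1)]

/-- The eight `q`-hypergeometric series (`f i` is `f_{i+1}`). The infinite sum is taken
in `ℤ⟦q⟧` with the topology of coefficientwise convergence, `ℤ` being discrete. -/
def f (i : Fin 8) : ℤ⟦X⟧ :=
  ∑' n : ℕ, summand i n

open Classical in
/-- A set `A` of natural numbers has (natural) density `d` if
`#{n < N : n ∈ A} / N → d` as `N → ∞`. -/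
def HasNaturalDensity (A : Set ℕ) (d : ℝ) : Prop :=
  Filter.Tendsto (fun N : ℕ => (((Finset.range N).filter (fun n => n ∈ A)).card : ℝ) / (N : ℝ))
    Filter.atTop (nhds d)

/-- A power series is lacunary if almost all of its coefficients vanish: the set of exponents
with zero coefficient has natural density one. -/
def IsLacunary (g : ℤ⟦X⟧) : Prop :=
  HasNaturalDensity {n : ℕ | PowerSeries.coeff n g = 0} 1

end

end QHyper

/-! Each `f_i` is rewritten as a sum of monomials `c q^n` whose exponents satisfy `A n + B = u² - d
v²` for fixed integers `A ≠ 0`, `B`, with `d = 2` for `f_1, …, f_4` and `d = 3` for `f_5, …, f_8`. A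
prime inert in `ℚ(√d)` never divides such a norm exactly once. The primes `p ≡ 3 mod 8` (for `d =
2`) and `p ≡ 5 mod 12` (for `d = 3`) are inert and their reciprocals have a divergent sum, so
sieving modulo `p²` shows that these exponents have density zero (`hasNaturalDensity_one_of_sieve`).

The rewriting is Bailey's lemma. If `β_n = ∑_r α_r K(n,r)` with `K(n,r) = 1/((q)_{n-r}
(q)_{n+r+κ})`, exchanging sums turns `∑ w_n β_n` into `∑ α_r γ_r`, where `γ_r = ∑_n w_n K(n,r)` is a
`q`-Gauss sum with a closed form (`sum_weight_mul_kernel_sub_mem`, `bailey_lemma`). Up to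
normalisation this is a Bailey pair relative to `a = q^κ`.

Five pairs suffice: `thetaSq` for `f_3` and `f_7`, `falseTheta` for `f_4`, `thetaTri` for `f_5`,
`hyperbolicSum q` for `f_6` and (in base `q²`) `f_8`, and `hyperbolicSum (q ^ 2)` for `f_1` and
`f_2`. Each is proved by checking that both sides satisfy the same first-order recurrence in `n`.

The `α_r` and the kernels have denominators, so the computation takes place in the fraction field of
`ℤ⟦q⟧`; congruences modulo `q^N ℤ⟦q⟧` replace limits. -/

namespace QHyper

/-! ### Bailey pairs from recurrences and summation by parts -/

section BaileyPairs

variable {K : Type*} [Field K]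

/-- The triangular number `n (n + 1) / 2`. -/
def tri (n : ℕ) : ℕ := (n ^ 2 + n) / 2

theorem two_mul_tri (n : ℕ) : 2 * tri n = n ^ 2 + n := by
  have h : 2 ∣ n ^ 2 + n := by
    have := Nat.even_mul_succ_self n
    rw [show n ^ 2 + n = n * (n + 1) by ring]
    exact this.two_dvd
  exact Nat.mul_div_cancel' h

theorem tri_succ (n : ℕ) : tri (n + 1) = tri n + (n + 1) := by
  have h1 := two_mul_tri n
  have h2 := two_mul_tri (n + 1)
  nlinarith

@[simp] theorem tri_zero : tri 0 = 0 := rfl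

/-- `(q; q)_n` in a field. -/
def eulerProd (q : K) (n : ℕ) : K := ∏ j ∈ Finset.range n, (1 - q ^ (j + 1))

theorem eulerProd_succ (q : K) (n : ℕ) :
    eulerProd q (n + 1) = eulerProd q n * (1 - q ^ (n + 1)) :=
  Finset.prod_range_succ _ _

@[simp] theorem eulerProd_zero (q : K) : eulerProd q 0 = 1 := rfl

theorem one_sub_ne_zero {q : K} (hq : ∀ n, q ^ (n + 1) ≠ 1) (n : ℕ) : 1 - q ^ (n + 1) ≠ 0 :=
  sub_ne_zero.2 (hq n).symm

theorem eulerProd_ne_zero {q : K} (hq : ∀ n, q ^ (n + 1) ≠ 1) (n : ℕ) : eulerProd q n ≠ 0 :=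
  Finset.prod_ne_zero_iff.2 fun j _ => one_sub_ne_zero hq j

/-- The kernel `1 / ((q)_{n-r} (q)_{n+r+κ})` of Bailey's lemma. -/
def kernel (q : K) (κ n r : ℕ) : K :=
  if r ≤ n then (eulerProd q (n - r) * eulerProd q (n + r + κ))⁻¹ else 0

theorem kernel_of_lt (q : K) (κ : ℕ) {n r : ℕ} (h : n < r) : kernel q κ n r = 0 :=
  if_neg (not_le.2 h)

theorem kernel_add (q : K) (κ r m : ℕ) :
    kernel q κ (r + m) r = (eulerProd q m * eulerProd q (r + m + r + κ))⁻¹ := by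
  simp [kernel]

theorem kernel_zero_zero (q : K) (κ : ℕ) : kernel q κ 0 0 = (eulerProd q κ)⁻¹ := by
  simp [kernel]

theorem kernel_succ_right {q : K} (hq : ∀ n, q ^ (n + 1) ≠ 1) (κ n r : ℕ) :
    q ^ r * (1 - q ^ (n + r + κ + 1)) * kernel q κ n (r + 1) =
      (q ^ r - q ^ n) * kernel q κ n r := by
  rcases lt_trichotomy n r with h | rfl | h
  · simp [kernel_of_lt, h, h.trans (Nat.lt_succ_self r)]
  · simp [kernel_of_lt]
  · obtain ⟨m, rfl⟩ := Nat.exists_eq_add_of_lt h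
    have e : kernel q κ (r + m + 1) (r + 1) =
        (eulerProd q m * eulerProd q (r + (m + 1) + r + κ + 1))⁻¹ := by
      rw [show r + m + 1 = r + 1 + m by ring, kernel_add,
        show r + 1 + m + (r + 1) + κ = (r + (m + 1) + r + κ) + 1 by ring]
    rw [e, show r + m + 1 = r + (m + 1) by ring, kernel_add, eulerProd_succ q m,
      eulerProd_succ q (r + (m + 1) + r + κ)]
    have h1 := one_sub_ne_zero hq m
    have h2 := one_sub_ne_zero hq (r + (m + 1) + r + κ)
    have h3 := eulerProd_ne_zero hq m
    have h4 := eulerProd_ne_zero hq (r + (m + 1) + r + κ)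
    field_simp
    ring

theorem kernel_succ_left {q : K} (hq : ∀ n, q ^ (n + 1) ≠ 1) (κ n r : ℕ) :
    (q ^ r - q ^ (n + 1)) * (1 - q ^ (n + r + κ + 1)) * kernel q κ (n + 1) r =
      q ^ r * kernel q κ n r := by
  rcases lt_trichotomy (n + 1) r with h | rfl | h
  · simp [kernel_of_lt, h, (Nat.lt_succ_self n).trans h]
  · simp [kernel_of_lt]
  · obtain ⟨m, hm⟩ := Nat.exists_eq_add_of_lt h
    obtain rfl : n = r + m := by omega
    rw [show r + m + 1 = r + (m + 1) by ring, kernel_add, kernel_add,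
      show r + (m + 1) + r + κ = (r + m + r + κ) + 1 by ring, eulerProd_succ q m,
      eulerProd_succ q (r + m + r + κ)]
    have h1 := one_sub_ne_zero hq m
    have h2 := one_sub_ne_zero hq (r + m + r + κ)
    have h3 := eulerProd_ne_zero hq m
    have h4 := eulerProd_ne_zero hq (r + m + r + κ)
    field_simp
    ring

theorem kernel_succ_right_eq {q : K} (h0 : q ≠ 0) (hq : ∀ n, q ^ (n + 1) ≠ 1) (κ n r : ℕ) :
    kernel q κ n (r + 1) =
      (q ^ r - q ^ n) / (q ^ r * (1 - q ^ (n + r + κ + 1))) * kernel q κ n r := by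
  have h := kernel_succ_right hq κ n r
  have h1 := one_sub_ne_zero hq (n + r + κ)
  field_simp
  linear_combination h

theorem kernel_eq_succ_left {q : K} (h0 : q ≠ 0) (hq : ∀ n, q ^ (n + 1) ≠ 1) (κ n r : ℕ) :
    kernel q κ n r =
      (q ^ r - q ^ (n + 1)) * (1 - q ^ (n + r + κ + 1)) / q ^ r * kernel q κ (n + 1) r := by
  have h := kernel_succ_left hq κ n r
  field_simp
  linear_combination -h

/-- `α` and `β` form a Bailey pair for the kernel `1 / ((q)_{n-r} (q)_{n+r+κ})`. -/
def IsBaileyPair (q : K) (κ : ℕ) (α β : ℕ → K) : Prop :=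
  ∀ n, β n = ∑ r ∈ Finset.range (n + 1), α r * kernel q κ n r

/-- A first-order recurrence with nonzero leading coefficient and one initial value determine `β`,
so it is enough that the sum over `r` obeys the same recurrence. That sum may run to `n + 1` at both
levels because `kernel q κ n (n + 1) = 0`. -/
theorem isBaileyPair_of_recurrence {q : K} {κ : ℕ} {α β : ℕ → K} (D E : ℕ → K)
    (hD : ∀ n, D n ≠ 0) (h0 : β 0 = α 0 * (eulerProd q κ)⁻¹)
    (hβ : ∀ n, D n * β (n + 1) = E n * β n)
    (hα : ∀ n, ∑ r ∈ Finset.range (n + 2),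
      (D n * kernel q κ (n + 1) r - E n * kernel q κ n r) * α r = 0) :
    IsBaileyPair q κ α β := by
  intro n
  induction n with
  | zero => simp [h0, kernel_zero_zero]
  | succ n ih =>
    apply mul_left_cancel₀ (hD n)
    rw [hβ, ih]
    have h := hα n
    simp only [sub_mul, Finset.sum_sub_distrib] at h
    rw [sub_eq_zero] at h
    rw [Finset.mul_sum, Finset.mul_sum]
    have e : ∑ r ∈ Finset.range (n + 2), E n * kernel q κ n r * α r =
        ∑ r ∈ Finset.range (n + 1), E n * kernel q κ n r * α r := by
      rw [Finset.sum_range_succ, kernel_of_lt q κ (Nat.lt_succ_self n)]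
      simp
    rw [e] at h
    calc _ = ∑ r ∈ Finset.range (n + 1), E n * kernel q κ n r * α r :=
          Finset.sum_congr rfl fun _ _ => by ring
      _ = _ := h.symm
      _ = _ := Finset.sum_congr rfl fun _ _ => by ring

/-- Summation by parts against the partial sums `V` of `v`. -/
theorem sum_mul_partialSum {V v G H x : ℕ → K} (hV : ∀ r, V (r + 1) = V r + v (r + 1))
    (hx : ∀ r, x r = G r - G (r + 1)) (hH : ∀ r, H (r + 1) - H r = G (r + 1) * v (r + 1))
    (h0 : H 0 = G 0 * V 0) (M : ℕ) :
    ∑ r ∈ Finset.range M, x r * V r = H M - G M * V M := by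
  induction M with
  | zero => simp [h0]
  | succ M ih =>
    rw [Finset.sum_range_succ, ih, hx, hV]
    linear_combination -hH M

/-- Summation by parts against a solution of `h (r + 2) = 2 + c r * h r`. -/
theorem sum_mul_twoStep {h c z H x : ℕ → K} (hh : ∀ r, h (r + 2) = 2 + c r * h r)
    (hx : ∀ r, x r = z r - c r * z (r + 2)) (hH : ∀ r, H (r + 1) - H r = 2 * z (r + 2))
    (h0 : H 0 = z 0 * h 0 + z 1 * h 1) (M : ℕ) :
    ∑ r ∈ Finset.range M, x r * h r = H M - (z M * h M + z (M + 1) * h (M + 1)) := by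
  induction M with
  | zero => simp [h0]
  | succ M ih =>
    rw [Finset.sum_range_succ, ih, hx, hh]
    linear_combination -hH M

/-- The partial theta sum `∑_{|j| ≤ r} q^{-j(j+1)/2}`. -/
def thetaTri (q : K) (r : ℕ) : K :=
  ∑ j ∈ Finset.range (r + 1), (if j = 0 then 1 else (1 + q ^ j) / q ^ tri j)

/-- The partial theta sum `∑_{|j| ≤ r} (-1)^j q^{-j^2}`. -/
def thetaSq (q : K) (r : ℕ) : K :=
  ∑ j ∈ Finset.range (r + 1), (if j = 0 then 1 else 2 * (-1) ^ j / q ^ (j ^ 2))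

/-- The partial false theta sum `∑_{j ≤ r} (-1)^j q^{-j^2-2j} (1 - q^{2j+1})`. -/
def falseTheta (q : K) (r : ℕ) : K :=
  ∑ j ∈ Finset.range (r + 1), (-1) ^ j * (1 - q ^ (2 * j + 1)) / q ^ (j ^ 2 + 2 * j)

/-- All kernels that occur are rational multiples of `Kr r`, so once a certificate is supplied every
side condition is an identity of rational functions. The pairs below follow the same pattern. -/
theorem isBaileyPair_thetaTri {q : K} (h0 : q ≠ 0) (hq : ∀ n, q ^ (n + 1) ≠ 1) :
    IsBaileyPair q 1 (fun r => (-1) ^ r * q ^ (2 * tri r) * thetaTri q r)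
      (fun n => (∏ j ∈ Finset.range (n + 1), (1 - q ^ (2 * j + 1)))⁻¹) := by
  have ne := one_sub_ne_zero hq
  refine isBaileyPair_of_recurrence (fun n => 1 - q ^ (2 * n + 3)) (fun _ => 1)
    (fun n => ne (2 * n + 2)) (by simp [thetaTri, eulerProd]) (fun n => ?_) (fun n => ?_)
  · have := ne (2 * n + 2)
    have h2 : ∏ j ∈ Finset.range (n + 1), (1 - q ^ (2 * j + 1)) ≠ 0 :=
      Finset.prod_ne_zero_iff.2 fun j _ => ne (2 * j)
    rw [Finset.prod_range_succ _ (n + 1), show 2 * (n + 1) + 1 = 2 * n + 2 + 1 by ring]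
    field_simp
  · set Kr : ℕ → K := kernel q 1 (n + 1) with hKr
    have kR : ∀ r, Kr (r + 1) = _ := kernel_succ_right_eq h0 hq 1 (n + 1)
    have kL : ∀ r, kernel q 1 n r = _ * Kr r := kernel_eq_succ_left h0 hq 1 n
    have hy := ne n
    -- `G` is an antidifference of the summand without its theta factor; summing by parts leaves `∑
    -- G v`, whose antidifference is `H`.
    have key := sum_mul_partialSum (V := thetaTri q) (v := fun j => (1 + q ^ j) / q ^ tri j)
      (G := fun r => q ^ (n + 1) / q ^ r * (1 - q ^ (n + r + 1 + 1)) *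
        ((-1) ^ r * q ^ (2 * tri r)) * Kr r)
      (H := fun r => q ^ (n + 1) / (1 - q ^ (n + 1)) * (-1) ^ r * q ^ tri r *
        (1 - q ^ (n + 1) / q ^ r) * (1 - q ^ (n + r + 1 + 1)) * Kr r)
      (x := fun r => ((1 - q ^ (2 * n + 3)) * Kr r - 1 * kernel q 1 n r) *
        ((-1) ^ r * q ^ (2 * tri r)))
      (fun r => by rw [thetaTri, Finset.sum_range_succ]; simp [thetaTri])
      (fun r => by
        have h1 := ne (n + 1 + r + 1)
        simp only [kR, kL, tri_succ]
        field_simp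
        ring)
      (fun r => by
        have h1 := ne (n + 1 + r + 1)
        simp only [kR, tri_succ]
        field_simp
        ring)
      (by simp only [thetaTri, tri_zero]; simp; field_simp; simp) (n + 2)
    -- Both boundary terms carry the factor `Kr (n + 2)`, which lies outside the support of the
    -- kernel.
    rw [show Kr (n + 2) = 0 from kernel_of_lt q 1 (Nat.lt_succ_self _)] at key
    simp only [mul_zero, zero_mul, sub_zero] at key
    rw [← key]
    exact Finset.sum_congr rfl fun r _ => by ring

theorem isBaileyPair_thetaSq {q : K} (h0 : q ≠ 0) (hq : ∀ n, q ^ (n + 1) ≠ 1)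
    (hq' : ∀ n, q ^ (n + 1) ≠ -1) :
    IsBaileyPair (q ^ 2) 1
      (fun r => q ^ (2 * r ^ 2 + r) * (1 - q ^ (2 * r + 1)) * thetaSq q r)
      (fun n => (∏ j ∈ Finset.range (2 * n + 1), (1 + q ^ (j + 1)))⁻¹) := by
  have h20 : q ^ 2 ≠ 0 := pow_ne_zero 2 h0
  have hq2 : ∀ n, (q ^ 2) ^ (n + 1) ≠ 1 := fun n => by
    rw [← pow_mul]; exact hq (2 * n + 1)
  have ne := one_sub_ne_zero hq
  have ne2 := one_sub_ne_zero hq2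
  have ne' : ∀ n, 1 + q ^ (n + 1) ≠ 0 := fun n h => hq' n (by linear_combination h)
  refine isBaileyPair_of_recurrence (fun n => (1 + q ^ (2 * n + 1 + 1)) * (1 + q ^ (2 * n + 2 + 1)))
    (fun _ => 1) (fun n => mul_ne_zero (ne' _) (ne' _)) ?_ (fun n => ?_) (fun n => ?_)
  · have h1 := ne' 0
    have h2 := ne2 0
    have h3 := ne 0
    simp [thetaSq, eulerProd] at *
    field_simp
    ring
  · have h1 := ne' (2 * n + 1)
    have h3 := ne' (2 * n + 2)
    have h2 : ∏ j ∈ Finset.range (2 * n + 1), (1 + q ^ (j + 1)) ≠ 0 :=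
      Finset.prod_ne_zero_iff.2 fun j _ => ne' j
    rw [show 2 * (n + 1) + 1 = 2 * n + 1 + 1 + 1 by ring, Finset.prod_range_succ,
      Finset.prod_range_succ]
    field_simp
  · set Kr : ℕ → K := kernel (q ^ 2) 1 (n + 1) with hKr
    have kR : ∀ r, Kr (r + 1) = _ := kernel_succ_right_eq h20 hq2 1 (n + 1)
    have kL : ∀ r, kernel (q ^ 2) 1 n r = _ * Kr r := kernel_eq_succ_left h20 hq2 1 n
    have hy := ne2 n
    have key := sum_mul_partialSum (V := thetaSq q) (v := fun j => 2 * (-1) ^ j / q ^ (j ^ 2))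
      (G := fun r => (q ^ 2) ^ (n + 1) / (q ^ 2) ^ r * (1 - (q ^ 2) ^ (n + 1 + r + 1)) *
        (1 + q ^ (2 * r)) * q ^ (2 * r ^ 2 + r) * Kr r)
      (H := fun r => 2 * (q ^ 2) ^ (n + 1) / (1 - (q ^ 2) ^ (n + 1)) * (-1) ^ r * q ^ (r ^ 2 + r) *
        (1 - (q ^ 2) ^ (n + 1) / (q ^ 2) ^ r) * (1 - (q ^ 2) ^ (n + 1 + r + 1)) * Kr r)
      (x := fun r => ((1 + q ^ (2 * n + 1 + 1)) * (1 + q ^ (2 * n + 2 + 1)) * Kr r -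
        1 * kernel (q ^ 2) 1 n r) * (q ^ (2 * r ^ 2 + r) * (1 - q ^ (2 * r + 1))))
      (fun r => by rw [thetaSq, Finset.sum_range_succ]; simp [thetaSq])
      (fun r => by
        have h1 := ne2 (n + 1 + r + 1)
        simp only [kR, kL]
        field_simp
        ring)
      (fun r => by
        have h1 := ne2 (n + 1 + r + 1)
        simp only [kR]
        field_simp
        ring)
      (by simp only [thetaSq]; simp; field_simp; ring_nf; simp) (n + 2)
    rw [show Kr (n + 2) = 0 from kernel_of_lt _ 1 (Nat.lt_succ_self _)] at key
    simp only [mul_zero, zero_mul, sub_zero] at key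
    rw [← key]
    exact Finset.sum_congr rfl fun r _ => by ring

theorem isBaileyPair_falseTheta {q : K} (h0 : q ≠ 0) (hq : ∀ n, q ^ (n + 1) ≠ 1)
    (hq' : ∀ n, q ^ (n + 1) ≠ -1) :
    IsBaileyPair (q ^ 2) 2
      (fun r => q ^ (2 * r ^ 2 + 3 * r) * (1 - q ^ (2 * r + 2)) * falseTheta q r)
      (fun n => (∏ j ∈ Finset.range (2 * n + 2), (1 + q ^ (j + 1)))⁻¹) := by
  have h20 : q ^ 2 ≠ 0 := pow_ne_zero 2 h0
  have hq2 : ∀ n, (q ^ 2) ^ (n + 1) ≠ 1 := fun n => by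
    rw [← pow_mul]; exact hq (2 * n + 1)
  have ne := one_sub_ne_zero hq
  have ne2 := one_sub_ne_zero hq2
  have ne' : ∀ n, 1 + q ^ (n + 1) ≠ 0 := fun n h => hq' n (by linear_combination h)
  refine isBaileyPair_of_recurrence (fun n => (1 + q ^ (2 * n + 2 + 1)) * (1 + q ^ (2 * n + 3 + 1)))
    (fun _ => 1) (fun n => mul_ne_zero (ne' _) (ne' _)) ?_ (fun n => ?_) (fun n => ?_)
  · have h1 := ne' 0
    have h2 := ne2 0
    have h3 := ne 0
    have h4 := ne 3
    have h5 := ne' 1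
    simp [falseTheta, eulerProd, Finset.prod_range_succ] at *
    field_simp
    ring
  · have h1 := ne' (2 * n + 2)
    have h3 := ne' (2 * n + 3)
    have h2 : ∏ j ∈ Finset.range (2 * n + 2), (1 + q ^ (j + 1)) ≠ 0 :=
      Finset.prod_ne_zero_iff.2 fun j _ => ne' j
    rw [show 2 * (n + 1) + 2 = 2 * n + 2 + 1 + 1 by ring, Finset.prod_range_succ,
      Finset.prod_range_succ]
    field_simp
  · set Kr : ℕ → K := kernel (q ^ 2) 2 (n + 1) with hKr
    have kR : ∀ r, Kr (r + 1) = _ := kernel_succ_right_eq h20 hq2 2 (n + 1)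
    have kL : ∀ r, kernel (q ^ 2) 2 n r = _ * Kr r := kernel_eq_succ_left h20 hq2 2 n
    have hy := ne2 n
    have key := sum_mul_partialSum (V := falseTheta q)
      (v := fun j => (-1) ^ j * (1 - q ^ (2 * j + 1)) / q ^ (j ^ 2 + 2 * j))
      (G := fun r => (q ^ 2) ^ (n + 1) / (q ^ 2) ^ r * (1 - (q ^ 2) ^ (n + 1 + r + 2)) *
        (1 + q ^ (2 * r + 1)) * q ^ (2 * r ^ 2 + 3 * r) * Kr r)
      (H := fun r => (q ^ 2) ^ (n + 1) / (1 - (q ^ 2) ^ (n + 1)) * (-1) ^ r * q ^ (r ^ 2 + r) *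
        (1 - q ^ (2 * r + 2)) *
        (1 - (q ^ 2) ^ (n + 1) / (q ^ 2) ^ r) * (1 - (q ^ 2) ^ (n + 1 + r + 2)) * Kr r)
      (x := fun r => ((1 + q ^ (2 * n + 2 + 1)) * (1 + q ^ (2 * n + 3 + 1)) * Kr r -
        1 * kernel (q ^ 2) 2 n r) * (q ^ (2 * r ^ 2 + 3 * r) * (1 - q ^ (2 * r + 2))))
      (fun r => by rw [falseTheta, Finset.sum_range_succ]; simp [falseTheta])
      (fun r => by
        have h1 := ne2 (n + 1 + r + 2)
        simp only [kR, kL]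
        field_simp
        ring)
      (fun r => by
        have h1 := ne2 (n + 1 + r + 2)
        simp only [kR]
        field_simp
        ring)
      (by simp only [falseTheta]; simp; field_simp; ring) (n + 2)
    rw [show Kr (n + 2) = 0 from kernel_of_lt _ 2 (Nat.lt_succ_self _)] at key
    simp only [mul_zero, zero_mul, sub_zero] at key
    rw [← key]
    exact Finset.sum_congr rfl fun r _ => by ring

/-- The polynomial `∑_{i + j = r} q^{ij}`. -/
def hyperbolicSum {R : Type*} [CommRing R] (q : R) (r : ℕ) : R :=
  ∑ i ∈ Finset.range (r + 1), q ^ (i * (r - i))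

/-- The two end terms are `1`, and `(i + 1)(j + 1) = ij + (i + j + 1)` handles the interior ones. -/
theorem hyperbolicSum_add_two {R : Type*} [CommRing R] (q : R) (r : ℕ) :
    hyperbolicSum q (r + 2) = 2 + q ^ (r + 1) * hyperbolicSum q r := by
  unfold hyperbolicSum
  rw [Finset.sum_range_succ, Finset.sum_range_succ', Finset.mul_sum]
  have : ∀ i ∈ Finset.range (r + 1), q ^ ((i + 1) * (r + 2 - (i + 1))) =
      q ^ (r + 1) * q ^ (i * (r - i)) := fun i hi => by
    obtain ⟨m, rfl⟩ := Nat.exists_eq_add_of_le (Finset.mem_range_succ_iff.1 hi)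
    rw [← pow_add, show i + m + 2 - (i + 1) = m + 1 by omega, Nat.add_sub_cancel_left]
    ring
  rw [Finset.sum_congr rfl this]
  simp
  ring

theorem isBaileyPair_hyperbolicSum {q : K} (h0 : q ≠ 0) (hq : ∀ n, q ^ (n + 1) ≠ 1) :
    IsBaileyPair q 2
      (fun r => (1 - q ^ (2 * r + 2)) * (-1) ^ r * q ^ tri r * hyperbolicSum q r)
      (fun n => eulerProd q n / eulerProd q (2 * n + 1)) := by
  have ne := one_sub_ne_zero hq
  have ne' : ∀ n, 1 + q ^ (n + 1) ≠ 0 := fun n h => by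
    apply ne (2 * n + 1)
    linear_combination (1 - q ^ (n + 1)) * h
  refine isBaileyPair_of_recurrence (fun n => (1 + q ^ (n + 1)) * (1 - q ^ (2 * n + 2 + 1)))
    (fun _ => 1) (fun n => mul_ne_zero (ne' _) (ne _)) ?_ (fun n => ?_) (fun n => ?_)
  · have h1 := ne 0
    have h2 := ne 1
    simp [hyperbolicSum, eulerProd, Finset.prod_range_succ] at *
    field_simp
  · have h1 := ne' n
    have h2 := ne (2 * n + 1)
    have h3 := ne (2 * n + 2)
    have h4 := eulerProd_ne_zero hq (2 * n + 1)
    rw [show 2 * (n + 1) + 1 = 2 * n + 1 + 1 + 1 by ring, eulerProd_succ, eulerProd_succ,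
      eulerProd_succ]
    field_simp
    ring
  · set Kr : ℕ → K := kernel q 2 (n + 1) with hKr
    have kR : ∀ r, Kr (r + 1) = _ * Kr r := kernel_succ_right_eq h0 hq 2 (n + 1)
    have kL : ∀ r, kernel q 2 n r = _ * Kr r := kernel_eq_succ_left h0 hq 2 n
    have hy := ne n
    -- The two-step recurrence of `hyperbolicSum` takes the place of partial sums: `z` absorbs the
    -- summand and `H` telescopes the inhomogeneous term `2 z (r + 2)`.
    have key := sum_mul_twoStep (h := hyperbolicSum q) (c := fun r => q ^ (r + 1))
      (z := fun r => q ^ (n + 1) / q ^ r * (1 + q ^ r) * (1 - q ^ (n + 1 + r + 2)) *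
        (1 - q ^ (n + 1 + r + 1)) * (-1) ^ r * q ^ tri r * Kr r)
      (H := fun r => -2 * q ^ (n + 1) / (1 - q ^ (n + 1)) * (-1) ^ r * q ^ tri (r + 1) *
        (1 - q ^ (n + 1) / q ^ r) * (1 - q ^ (n + 1) / q ^ (r + 1)) *
        (1 - q ^ (n + 1 + r + 2)) * Kr r)
      (x := fun r => ((1 + q ^ (n + 1)) * (1 - q ^ (2 * n + 2 + 1)) * Kr r -
        1 * kernel q 2 n r) * ((1 - q ^ (2 * r + 2)) * (-1) ^ r * q ^ tri r))
      (hyperbolicSum_add_two q)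
      (fun r => by
        have h1 := ne (n + 1 + r + 2)
        have h2 := ne (n + 1 + (r + 1) + 2)
        simp only [kR, kL, tri_succ]
        field_simp
        ring)
      (fun r => by
        have h1 := ne (n + 1 + r + 2)
        have h2 := ne (n + 1 + (r + 1) + 2)
        simp only [kR, tri_succ]
        field_simp
        ring)
      (by
        have h1 := ne (n + 1 + 2)
        simp only [kR, tri_succ, tri_zero, hyperbolicSum, Finset.sum_range_succ,
          Finset.sum_range_zero]
        simp at h1 ⊢
        field_simp
        ring) (n + 2)
    rw [show Kr (n + 2) = 0 from kernel_of_lt _ 2 (by omega),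
      show Kr (n + 2 + 1) = 0 from kernel_of_lt _ 2 (by omega)] at key
    simp only [mul_zero, zero_mul, sub_zero, add_zero] at key
    rw [← key]
    exact Finset.sum_congr rfl fun r _ => by ring

theorem isBaileyPair_hyperbolicSum_sq {q : K} (h0 : q ≠ 0) (hq : ∀ n, q ^ (n + 1) ≠ 1) :
    IsBaileyPair q 2
      (fun r => (1 - q ^ (2 * r + 2)) * (-1) ^ r * hyperbolicSum (q ^ 2) r)
      (fun n => (-1) ^ n / (eulerProd (q ^ 2) n * (1 - q ^ (2 * n + 1)))) := by
  have ne := one_sub_ne_zero hq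
  have hq2 : ∀ n, (q ^ 2) ^ (n + 1) ≠ 1 := fun n => by
    rw [← pow_mul]; exact hq (2 * n + 1)
  refine isBaileyPair_of_recurrence
    (fun n => (1 - q ^ (2 * n + 1 + 1)) * (1 - q ^ (2 * n + 2 + 1)))
    (fun n => -(1 - q ^ (2 * n + 1))) (fun n => mul_ne_zero (ne _) (ne _)) ?_ (fun n => ?_)
    (fun n => ?_)
  · have h1 := ne 0
    have h2 := ne 1
    simp [hyperbolicSum, eulerProd, Finset.prod_range_succ] at *
    field_simp
  · have h1 := ne (2 * n)
    have h2 := ne (2 * n + 1)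
    have h3 := ne (2 * n + 2)
    have h4 := eulerProd_ne_zero hq2 n
    have h5 := one_sub_ne_zero hq2 n
    rw [eulerProd_succ, show 2 * (n + 1) + 1 = 2 * n + 2 + 1 by ring]
    field_simp
    ring
  · set Kr : ℕ → K := kernel q 2 (n + 1) with hKr
    have kR : ∀ r, Kr (r + 1) = _ * Kr r := kernel_succ_right_eq h0 hq 2 (n + 1)
    have kL : ∀ r, kernel q 2 n r = _ * Kr r := kernel_eq_succ_left h0 hq 2 n
    have key := sum_mul_twoStep (h := hyperbolicSum (q ^ 2)) (c := fun r => (q ^ 2) ^ (r + 1))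
      (z := fun r => ((1 - q ^ (n + 1) / q ^ r) + (1 - q ^ r * q ^ (n + 1))) *
        (1 - q ^ (n + 1 + r + 2)) * (1 - q ^ (n + 1 + r + 1)) * (-1) ^ r * Kr r)
      (H := fun r => -2 * (-1) ^ r *
        (1 - q ^ (n + 1) / q ^ r) * (1 - q ^ (n + 1) / q ^ (r + 1)) *
        (1 - q ^ (n + 1 + r + 2)) * Kr r)
      (x := fun r => ((1 - q ^ (2 * n + 1 + 1)) * (1 - q ^ (2 * n + 2 + 1)) * Kr r -
        -(1 - q ^ (2 * n + 1)) * kernel q 2 n r) * ((1 - q ^ (2 * r + 2)) * (-1) ^ r))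
      (hyperbolicSum_add_two (q ^ 2))
      (fun r => by
        have h1 := ne (n + 1 + r + 2)
        have h2 := ne (n + 1 + (r + 1) + 2)
        simp only [kR, kL]
        field_simp
        ring)
      (fun r => by
        have h1 := ne (n + 1 + r + 2)
        have h2 := ne (n + 1 + (r + 1) + 2)
        simp only [kR]
        field_simp
        ring)
      (by
        have h1 := ne (n + 1 + 2)
        simp only [kR, hyperbolicSum, Finset.sum_range_succ, Finset.sum_range_zero]
        simp at h1 ⊢
        field_simp
        ring) (n + 2)
    rw [show Kr (n + 2) = 0 from kernel_of_lt _ 2 (by omega),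
      show Kr (n + 2 + 1) = 0 from kernel_of_lt _ 2 (by omega)] at key
    simp only [mul_zero, zero_mul, sub_zero, add_zero] at key
    rw [← key]
    exact Finset.sum_congr rfl fun r _ => by ring

theorem kernel_one_eq (q : K) {n r : ℕ} (hq : ∀ n, q ^ (n + 1) ≠ 1) :
    kernel q 1 n r = (1 - q ^ (n + r + 1 + 1)) * kernel q 2 n r := by
  rcases le_or_gt r n with h | h
  · have h1 := one_sub_ne_zero hq (n + r + 1)
    have h2 := eulerProd_ne_zero hq (n - r)
    have h3 := eulerProd_ne_zero hq (n + r + 1)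
    rw [kernel, if_pos h, kernel, if_pos h, show n + r + 2 = n + r + 1 + 1 by ring,
      eulerProd_succ q (n + r + 1)]
    field_simp
  · simp [kernel_of_lt, h]

/-- Passage from `a = q²` to `a = q` with `β` unchanged, by splitting `(1 - q^{2r+2}) K₂(n,r) =
K₁(n,r) - q^{2r+2} K₁(n,r+1)` and shifting the index in the second part. It lets `f_1` use the pair
of `f_2`. -/
theorem isBaileyPair_one_of_two {q : K} (h0 : q ≠ 0) (hq : ∀ n, q ^ (n + 1) ≠ 1) {A β : ℕ → K}
    (h : IsBaileyPair q 2 (fun r => (1 - q ^ (2 * r + 2)) * A r) β) :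
    IsBaileyPair q 1 (fun r => A r - if r = 0 then 0 else q ^ (2 * r) * A (r - 1)) β := by
  intro n
  rw [h n]
  have e : ∀ r, (1 - q ^ (2 * r + 2)) * A r * kernel q 2 n r =
      A r * kernel q 1 n r - q ^ (2 * (r + 1)) * A r * kernel q 1 n (r + 1) := fun r => by
    have h1 := one_sub_ne_zero hq (n + r + 1)
    rw [kernel_succ_right_eq h0 hq, kernel_one_eq q hq]
    field_simp
    ring
  rw [Finset.sum_congr rfl fun r _ => e r]
  simp only [sub_mul, Finset.sum_sub_distrib]
  congr 1
  rw [Finset.sum_range_succ, kernel_of_lt q 1 (Nat.lt_succ_self n),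
    Finset.sum_range_succ' _ n]
  simp

end BaileyPairs
end QHyper

namespace QHyper

/-! ### The `q`-Gauss sum with first parameter a power of the base -/

section Gauss

variable {K : Type*} [Field K]

/-- The `q`-Pochhammer symbol `(a; Q)_n` in a field. -/
def poch (a Q : K) (n : ℕ) : K := ∏ j ∈ Finset.range n, (1 - a * Q ^ j)

theorem poch_succ (a Q : K) (n : ℕ) : poch a Q (n + 1) = poch a Q n * (1 - a * Q ^ n) :=
  Finset.prod_range_succ _ _

theorem poch_succ' (a Q : K) (n : ℕ) : poch a Q (n + 1) = (1 - a) * poch (a * Q) Q n := by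
  rw [poch, Finset.prod_range_succ', mul_comm]
  simp only [poch, pow_zero, mul_one, pow_succ']
  congr 1
  exact Finset.prod_congr rfl fun _ _ => by ring

@[simp] theorem poch_zero (a Q : K) : poch a Q 0 = 1 := rfl

theorem poch_ne_zero {a Q : K} (h : ∀ n, a * Q ^ n ≠ 1) (n : ℕ) : poch a Q n ≠ 0 :=
  Finset.prod_ne_zero_iff.2 fun j _ => sub_ne_zero.2 (h j).symm

theorem eulerProd_eq_poch (Q : K) (n : ℕ) : eulerProd Q n = poch Q Q n := by
  simp only [eulerProd, poch, pow_succ']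

theorem eulerProd_add (Q : K) (m n : ℕ) :
    eulerProd Q (m + n) = eulerProd Q m * poch (Q ^ (m + 1)) Q n := by
  rw [eulerProd, Finset.prod_range_add]
  congr 1
  exact Finset.prod_congr rfl fun _ _ => by ring

/-- The numerator product `∏_{j<n} (τ - D Q^j)`. -/
def shiftProd (τ D Q : K) (n : ℕ) : K := ∏ j ∈ Finset.range n, (τ - D * Q ^ j)

theorem shiftProd_succ (τ D Q : K) (n : ℕ) :
    shiftProd τ D Q (n + 1) = shiftProd τ D Q n * (τ - D * Q ^ n) :=
  Finset.prod_range_succ _ _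

@[simp] theorem shiftProd_zero (τ D Q : K) : shiftProd τ D Q 0 = 1 := rfl

theorem shiftProd_add (τ D Q : K) (m n : ℕ) :
    shiftProd τ D Q (m + n) = shiftProd τ D Q m * shiftProd τ (D * Q ^ m) Q n := by
  rw [shiftProd, Finset.prod_range_add]
  congr 1
  exact Finset.prod_congr rfl fun _ _ => by ring

/-- The terms of the `q`-Gauss sum with first parameter `Q^k`. -/
def gaussTerm (τ D Q : K) (k m : ℕ) : K :=
  poch (Q ^ k) Q m * shiftProd τ D Q m / (poch Q Q m * poch (D * Q ^ k) Q m)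

/-- A contiguous relation in `k` for truncated sums. Without the boundary term it gives `S_{k+1} =
S_k (1 - D Q^k)/(1 - τ Q^k)`, so the `q`-Gauss evaluation reduces to induction on `k`. -/
theorem gaussTerm_telescope {τ D Q : K} (hQ : ∀ n, Q ^ (n + 1) ≠ 1) (hD : ∀ n, D * Q ^ n ≠ 1)
    (k M : ℕ) :
    (1 - τ * Q ^ k) * ∑ m ∈ Finset.range (M + 1), gaussTerm τ D Q (k + 1) m -
      (1 - D * Q ^ k) * ∑ m ∈ Finset.range (M + 1), gaussTerm τ D Q k m =
      -Q ^ k * (τ - D * Q ^ M) * gaussTerm τ D Q (k + 1) M := by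
  induction M with
  | zero =>
    simp [gaussTerm]
    ring
  | succ M ih =>
    rw [Finset.sum_range_succ _ (M + 1), Finset.sum_range_succ _ (M + 1)]
    have hDk : ∀ k n, D * Q ^ k * Q ^ n ≠ 1 := fun k n => by
      rw [mul_assoc, ← pow_add]; exact hD _
    have h1 : 1 - D * Q ^ k ≠ 0 := sub_ne_zero.2 (hD k).symm
    have h2 : 1 - Q * Q ^ M ≠ 0 := by
      rw [← pow_succ']; exact sub_ne_zero.2 (hQ M).symm
    have h3 : 1 - D * Q ^ (k + 1) * Q ^ M ≠ 0 := sub_ne_zero.2 (hDk (k + 1) M).symm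
    have h4 : poch Q Q M ≠ 0 := by
      rw [← eulerProd_eq_poch]; exact eulerProd_ne_zero hQ M
    have h5 : poch (D * Q ^ (k + 1)) Q M ≠ 0 := poch_ne_zero (hDk (k + 1)) M
    have e1 : gaussTerm τ D Q (k + 1) (M + 1) = gaussTerm τ D Q (k + 1) M *
        ((1 - Q ^ (k + 1) * Q ^ M) * (τ - D * Q ^ M) /
          ((1 - Q * Q ^ M) * (1 - D * Q ^ (k + 1) * Q ^ M))) := by
      simp only [gaussTerm, poch_succ, shiftProd_succ]
      field_simp
    have e2 : gaussTerm τ D Q k (M + 1) = gaussTerm τ D Q (k + 1) M *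
        ((1 - Q ^ k) * (τ - D * Q ^ M) / ((1 - Q * Q ^ M) * (1 - D * Q ^ k))) := by
      simp only [gaussTerm]
      rw [poch_succ' (Q ^ k), poch_succ' (D * Q ^ k), poch_succ Q, shiftProd_succ, ← pow_succ,
        mul_assoc D, ← pow_succ]
      field_simp
    rw [mul_add, mul_add, add_sub_add_comm, ih, e1, e2, pow_succ Q M]
    rw [pow_succ Q k] at h3 ⊢
    generalize gaussTerm τ D Q (k + 1) M = g
    generalize Q ^ k = A at *
    generalize Q ^ M = z at *
    generalize hu : 1 - Q * z = u at *
    generalize hv : 1 - D * (A * Q) * z = v at *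
    generalize hw : 1 - D * A = w at *
    field_simp
    rw [← hu, ← hv]
    ring

end Gauss

/-! ### Congruences modulo `q^N` in the fraction field, and Bailey's lemma -/

noncomputable section Transfer

/-- The field of fractions of `ℤ⟦q⟧`. -/
abbrev Frac : Type := FractionRing ℤ⟦X⟧

/-- The embedding of `ℤ⟦q⟧` into its field of fractions. -/
abbrev ι : ℤ⟦X⟧ →+* Frac := algebraMap ℤ⟦X⟧ Frac

theorem ι_injective : Function.Injective ι := IsFractionRing.injective ℤ⟦X⟧ Frac

/-- The fractional ideal `q^N ℤ⟦q⟧`. -/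
def powIdeal (N : ℕ) : Submodule ℤ⟦X⟧ Frac := Submodule.span ℤ⟦X⟧ {ι (q ^ N)}

theorem mem_powIdeal {N : ℕ} {x : Frac} : x ∈ powIdeal N ↔ ∃ g, ι (g * q ^ N) = x := by
  simp [powIdeal, Submodule.mem_span_singleton, Algebra.smul_def]

theorem ι_mem_powIdeal {N : ℕ} {g : ℤ⟦X⟧} : ι g ∈ powIdeal N ↔ q ^ N ∣ g := by
  rw [mem_powIdeal]
  constructor
  · rintro ⟨h, hh⟩
    exact ⟨h, by rw [← ι_injective hh, mul_comm]⟩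
  · rintro ⟨h, rfl⟩
    exact ⟨h, by rw [mul_comm]⟩

theorem powIdeal_antitone : Antitone powIdeal := fun a b hab x hx => by
  obtain ⟨g, rfl⟩ := mem_powIdeal.1 hx
  exact ι_mem_powIdeal.2 ((pow_dvd_pow q hab).trans (Dvd.intro_left g rfl))

theorem mul_mem_powIdeal {a b : ℕ} {x y : Frac} (hx : x ∈ powIdeal a) (hy : y ∈ powIdeal b) :
    x * y ∈ powIdeal (a + b) := by
  obtain ⟨g, rfl⟩ := mem_powIdeal.1 hx
  obtain ⟨h, rfl⟩ := mem_powIdeal.1 hy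
  rw [← map_mul, ι_mem_powIdeal, pow_add]
  exact mul_dvd_mul (Dvd.intro_left g rfl) (Dvd.intro_left h rfl)

theorem ι_mem_zero (g : ℤ⟦X⟧) : ι g ∈ powIdeal 0 := ι_mem_powIdeal.2 (by simp)

theorem ι_ne_zero {v : ℤ⟦X⟧} (hv : PowerSeries.constantCoeff v = 1) : ι v ≠ 0 := fun h => by
  rw [map_eq_zero_iff _ ι_injective] at h
  simp [h] at hv

theorem ι_frac (u : ℤ⟦X⟧) {v : ℤ⟦X⟧} (hv : PowerSeries.constantCoeff v = 1) :
    ι (frac u v) = ι u / ι v := by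
  rw [eq_div_iff (ι_ne_zero hv), ← map_mul, frac_mul u hv]

theorem div_mem_powIdeal {N : ℕ} {x : Frac} (hx : x ∈ powIdeal N) {v : ℤ⟦X⟧}
    (hv : PowerSeries.constantCoeff v = 1) : x / ι v ∈ powIdeal N := by
  have h : (ι v)⁻¹ = ι (frac 1 v) := by rw [ι_frac 1 hv]; simp
  rw [div_eq_mul_inv, h]
  simpa using mul_mem_powIdeal hx (ι_mem_zero (frac 1 v))

theorem mul_mem_powIdeal_left {N : ℕ} {x : Frac} (g : ℤ⟦X⟧) (hx : x ∈ powIdeal N) :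
    ι g * x ∈ powIdeal N := by
  simpa using mul_mem_powIdeal (ι_mem_zero g) hx

theorem ι_qPoch (a b : ℤ⟦X⟧) (n : ℕ) : ι (qPoch a b n) = poch (ι a) (ι b) n := by
  simp [qPoch, poch, map_prod]

theorem ι_pow_ne_one {b : ℤ⟦X⟧} (hb : PowerSeries.constantCoeff b = 0) (n : ℕ) :
    ι b ^ (n + 1) ≠ 1 := fun h => by
  rw [← map_pow, ← map_one ι] at h
  have := congrArg PowerSeries.constantCoeff (ι_injective h)
  simp [hb] at this

theorem ι_mul_pow_ne_one {d : ℤ⟦X⟧} (hd : PowerSeries.constantCoeff d = 0) (b : ℤ⟦X⟧) (n : ℕ) :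
    ι d * ι b ^ n ≠ 1 := fun h => by
  rw [← map_pow, ← map_mul, ← map_one ι] at h
  have := congrArg PowerSeries.constantCoeff (ι_injective h)
  simp [hd] at this

theorem shiftProd_mem_powIdeal {t d : ℤ⟦X⟧} (ht : PowerSeries.constantCoeff t = 0)
    (hd : PowerSeries.constantCoeff d = 0) (b : ℤ⟦X⟧) (n : ℕ) :
    shiftProd (ι t) (ι d) (ι b) n ∈ powIdeal n := by
  induction n with
  | zero => simpa using ι_mem_zero 1
  | succ n ih =>
    rw [shiftProd_succ]
    refine mul_mem_powIdeal ih ?_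
    rw [← map_pow, ← map_mul, ← map_sub, ι_mem_powIdeal, pow_one, PowerSeries.X_dvd_iff]
    simp [ht, hd]

/-- The `q`-Gauss sum modulo `q^M`. For `k = 0` only the term `m = 0` survives, since `poch 1 _ m`
vanishes for `m > 0`. -/
theorem sum_gaussTerm_sub_mem {b t d : ℤ⟦X⟧} (hb : PowerSeries.constantCoeff b = 0)
    (ht : PowerSeries.constantCoeff t = 0) (hd : PowerSeries.constantCoeff d = 0) (k M : ℕ) :
    ∑ m ∈ Finset.range M, gaussTerm (ι t) (ι d) (ι b) k m -
      poch (ι d) (ι b) k / poch (ι t) (ι b) k ∈ powIdeal M := by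
  induction k with
  | zero =>
    rcases M with _ | M
    · simpa using Submodule.neg_mem _ (ι_mem_zero 1)
    · rw [Finset.sum_range_succ', Finset.sum_eq_zero]
      · simp [gaussTerm]
      · intro m _
        simp [gaussTerm, poch_succ']
  | succ k ih =>
    rcases M with _ | M
    · rw [Finset.sum_range_zero, zero_sub]
      refine Submodule.neg_mem _ ?_
      rw [← ι_qPoch, ← ι_qPoch]
      exact div_mem_powIdeal (ι_mem_zero _) (constantCoeff_qPoch b _ ht)
    · have htel := gaussTerm_telescope (τ := ι t) (ι_pow_ne_one hb) (ι_mul_pow_ne_one hd b) k M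
      have h1 : 1 - ι t * ι b ^ k ≠ 0 := sub_ne_zero.2 (ι_mul_pow_ne_one ht b k).symm
      have h2 : poch (ι t) (ι b) k ≠ 0 := poch_ne_zero (ι_mul_pow_ne_one ht b) k
      have e : ∑ m ∈ Finset.range (M + 1), gaussTerm (ι t) (ι d) (ι b) (k + 1) m -
          poch (ι d) (ι b) (k + 1) / poch (ι t) (ι b) (k + 1) =
          (ι (1 - d * b ^ k) * (∑ m ∈ Finset.range (M + 1), gaussTerm (ι t) (ι d) (ι b) k m -
            poch (ι d) (ι b) k / poch (ι t) (ι b) k) +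
          ι (-b ^ k) * ((ι t - ι d * ι b ^ M) * gaussTerm (ι t) (ι d) (ι b) (k + 1) M)) /
            ι (1 - t * b ^ k) := by
        have h3 : ι (1 - t * b ^ k) = 1 - ι t * ι b ^ k := by simp
        have h4 : poch (ι d) (ι b) k * (1 - ι d * ι b ^ k) /
            (poch (ι t) (ι b) k * (1 - ι t * ι b ^ k)) * (1 - ι t * ι b ^ k) =
            poch (ι d) (ι b) k / poch (ι t) (ι b) k * (1 - ι d * ι b ^ k) := by
          rw [div_mul_eq_mul_div, mul_div_mul_right _ _ h1, div_mul_eq_mul_div]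
        rw [h3, eq_div_iff h1, poch_succ, poch_succ, sub_mul, h4]
        simp only [map_sub, map_one, map_mul, map_pow, map_neg]
        linear_combination htel
      rw [e]
      refine div_mem_powIdeal (Submodule.add_mem _ (mul_mem_powIdeal_left _ ih)
        (mul_mem_powIdeal_left _ ?_)) (by simp [ht])
      -- The boundary factor lengthens `shiftProd` from `M` to `M + 1`, which supplies the missing
      -- power of `q`.
      have h4 : (ι t - ι d * ι b ^ M) * gaussTerm (ι t) (ι d) (ι b) (k + 1) M =
          ι (qPoch (b ^ (k + 1)) b M) * shiftProd (ι t) (ι d) (ι b) (M + 1) /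
            ι (qPoch b b M * qPoch (d * b ^ (k + 1)) b M) := by
        simp only [gaussTerm, ι_qPoch, map_mul, map_pow, shiftProd_succ]
        ring
      rw [h4]
      refine div_mem_powIdeal (mul_mem_powIdeal_left _ (shiftProd_mem_powIdeal ht hd b _)) ?_
      rw [map_mul, constantCoeff_qPoch b _ hb, constantCoeff_qPoch b _ (by simp [hd]), mul_one]

/-- The weights in Bailey's lemma with `ρ₁ = q` and `τ = a q / ρ₁ ρ₂`. -/
def weight (τ Q : Frac) (κ n : ℕ) : Frac := eulerProd Q n * shiftProd τ (Q ^ κ) Q n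

/-- The weights conjugate to `weight`. -/
def conjWeight (τ Q : Frac) (κ r : ℕ) : Frac :=
  eulerProd Q r * shiftProd τ (Q ^ (κ + 1)) Q r / (eulerProd Q (r + κ) * poch τ Q (r + 1))

/-- Putting `n = r + m` gives a `q`-Gauss sum: the choice `ρ₁ = q` makes its first parameter
`b^{r+1}`, a power of the base. The pair has parameter `κ + 1`, while `conjWeight` is indexed by
`κ`. -/
theorem sum_weight_mul_kernel_sub_mem {b t : ℤ⟦X⟧} (hb : PowerSeries.constantCoeff b = 0)
    (ht : PowerSeries.constantCoeff t = 0) (κ r N : ℕ) :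
    ∑ n ∈ Finset.range N, weight (ι t) (ι b) (κ + 1) n * kernel (ι b) (κ + 1) n r -
      conjWeight (ι t) (ι b) κ r ∈ powIdeal N := by
  have hbk : ∀ k, PowerSeries.constantCoeff (b ^ (k + 1)) = 0 := fun k => by simp [hb]
  have heul : ∀ n, eulerProd (ι b) n = ι (qPoch b b n) := fun n => by
    rw [ι_qPoch, eulerProd_eq_poch]
  have hne : ∀ n, eulerProd (ι b) n ≠ 0 := eulerProd_ne_zero (ι_pow_ne_one hb)
  have hsp : ∀ n, shiftProd (ι t) (ι b ^ (κ + 1)) (ι b) n ∈ powIdeal n := fun n => by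
    rw [← map_pow]; exact shiftProd_mem_powIdeal ht (hbk κ) b n
  -- For `N ≤ r` the truncated sum is empty of nonzero terms, and `conjWeight` is itself divisible
  -- by `q^r`.
  rcases le_or_gt N r with h | h
  · rw [Finset.sum_eq_zero fun n hn => by
      rw [kernel_of_lt _ _ ((Finset.mem_range.1 hn).trans_le h), mul_zero], zero_sub]
    refine Submodule.neg_mem _ (powIdeal_antitone h ?_)
    rw [conjWeight, heul, heul, ← ι_qPoch, ← map_mul]
    refine div_mem_powIdeal (mul_mem_powIdeal_left _ (hsp r)) ?_
    rw [map_mul, constantCoeff_qPoch b _ hb, constantCoeff_qPoch b _ ht, mul_one]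
  · obtain ⟨M, rfl⟩ := Nat.exists_eq_add_of_le h.le
    rw [Finset.sum_range_add, Finset.sum_eq_zero fun n hn => by
      rw [kernel_of_lt _ _ (Finset.mem_range.1 hn), mul_zero], zero_add]
    have hg := sum_gaussTerm_sub_mem hb ht (hbk (κ + r)) (r + 1) M
    rw [map_pow] at hg
    set c : Frac := eulerProd (ι b) r * shiftProd (ι t) (ι b ^ (κ + 1)) (ι b) r /
      eulerProd (ι b) (r + κ + (r + 1)) with hc
    have hcm : c ∈ powIdeal r := by
      rw [hc, heul, heul]
      exact div_mem_powIdeal (mul_mem_powIdeal_left _ (hsp r)) (constantCoeff_qPoch b _ hb)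
    have e1 : ∀ m, weight (ι t) (ι b) (κ + 1) (r + m) * kernel (ι b) (κ + 1) (r + m) r =
        c * gaussTerm (ι t) (ι b ^ (κ + r + 1)) (ι b) (r + 1) m := fun m => by
      have h1 := hne (r + κ + (r + 1))
      have h2 := hne m
      have h3 : poch (ι b ^ (r + κ + (r + 1) + 1)) (ι b) m ≠ 0 := poch_ne_zero (fun n => by
        rw [← map_pow]; exact ι_mul_pow_ne_one (hbk _) b n) m
      rw [weight, kernel_add, hc, gaussTerm, eulerProd_add _ r m, shiftProd_add,
        show r + m + r + (κ + 1) = r + κ + (r + 1) + m by ring, eulerProd_add _ _ m,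
        ← eulerProd_eq_poch, ← pow_add, ← pow_add,
        show κ + r + 1 + (r + 1) = r + κ + (r + 1) + 1 by ring,
        show κ + 1 + r = κ + r + 1 by ring]
      field_simp
    have e2 : conjWeight (ι t) (ι b) κ r =
        c * (poch (ι b ^ (κ + r + 1)) (ι b) (r + 1) / poch (ι t) (ι b) (r + 1)) := by
      have h1 := hne (r + κ)
      have h3 : poch (ι b ^ (κ + r + 1)) (ι b) (r + 1) ≠ 0 := poch_ne_zero (fun n => by
        rw [← map_pow]; exact ι_mul_pow_ne_one (hbk _) b n) _
      have h2 : poch (ι t) (ι b) (r + 1) ≠ 0 := poch_ne_zero (ι_mul_pow_ne_one ht b) _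
      rw [conjWeight, hc, eulerProd_add _ (r + κ) (r + 1), show r + κ + 1 = κ + r + 1 by ring]
      field_simp
    rw [Finset.sum_congr rfl fun m _ => e1 m, ← Finset.mul_sum, e2, ← mul_sub]
    exact mul_mem_powIdeal hcm hg

/-- Bailey's lemma modulo `q^N`, transferred to `ℤ⟦q⟧`. -/
theorem bailey_lemma {b t : ℤ⟦X⟧} (hb : PowerSeries.constantCoeff b = 0)
    (ht : PowerSeries.constantCoeff t = 0) {κ : ℕ} {α β : ℕ → Frac}
    (h : IsBaileyPair (ι b) (κ + 1) α β) (c : Frac) (hα : ∀ r, c * α r ∈ powIdeal 0)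
    {s A : ℕ → ℤ⟦X⟧} (hs : ∀ n, ι (s n) = c * (weight (ι t) (ι b) (κ + 1) n * β n))
    (hA : ∀ r, ι (A r) = c * (α r * conjWeight (ι t) (ι b) κ r)) (N : ℕ) :
    q ^ N ∣ ∑ n ∈ Finset.range N, s n - ∑ r ∈ Finset.range N, A r := by
  rw [← ι_mem_powIdeal, map_sub, map_sum, map_sum]
  have e : ∑ n ∈ Finset.range N, ι (s n) = ∑ r ∈ Finset.range N, c * α r *
      ∑ n ∈ Finset.range N, weight (ι t) (ι b) (κ + 1) n * kernel (ι b) (κ + 1) n r := by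
    simp only [Finset.mul_sum]
    rw [Finset.sum_comm]
    refine Finset.sum_congr rfl fun n hn => ?_
    rw [hs, h n, Finset.mul_sum, Finset.mul_sum]
    refine (Finset.sum_congr rfl fun r _ => by ring).trans
      (Finset.sum_subset (Finset.range_mono (Finset.mem_range.1 hn)) fun r _ hr => ?_)
    rw [kernel_of_lt _ _ (by simpa using hr)]
    simp
  rw [e, ← Finset.sum_sub_distrib]
  refine Submodule.sum_mem _ fun r _ => ?_
  rw [hA, ← mul_assoc, ← mul_sub]
  simpa using mul_mem_powIdeal (hα r) (sum_weight_mul_kernel_sub_mem hb ht κ r N)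

end Transfer
end QHyper

namespace QHyper

/-! ### A sieve by squares of inert primes -/

section Density

open Filter Topology ArithmeticFunction.vonMangoldt in
/-- The sum of the reciprocals of the primes in an invertible residue class diverges. -/
theorem not_summable_inv_primes_mod {m : ℕ} [NeZero m] {a : ZMod m} (ha : IsUnit a) :
    ¬ Summable fun n : ℕ => if n.Prime ∧ (n : ZMod m) = a then (1 : ℝ) / n else 0 := by
  intro hg
  have hh := summable_residueClass_non_primes_div a
  obtain ⟨C, hC⟩ := LSeries_residueClass_lower_bound ha
  -- Each `u s n` tends to `0` as `s → 0⁺`. If the reciprocals were summable, dominated convergence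
  -- would give `∑ u s n → 0`, whereas the pole of the L-series at `1` keeps this sum above `1/φ(m)
  -- - C s`.
  set u : ℝ → ℕ → ℝ := fun s n => s * (residueClass a n / (n : ℝ) ^ (1 + s)) with hu
  have hpos : ∀ᶠ s : ℝ in 𝓝[>] 0, 0 < s := eventually_mem_nhdsWithin
  have hle1 : ∀ᶠ s : ℝ in 𝓝[>] 0, s ≤ 1 :=
    (eventually_le_nhds zero_lt_one).filter_mono nhdsWithin_le_nhds
  have hdiv : ∀ s : ℝ, 0 < s → ∀ n : ℕ,
      residueClass a n / (n : ℝ) ^ (1 + s) ≤ residueClass a n / n := fun s hs n => by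
    rcases n.eq_zero_or_pos with rfl | hn
    · simp
    · refine div_le_div_of_nonneg_left (residueClass_nonneg a _) (mod_cast hn) ?_
      conv_lhs => rw [← Real.rpow_one n]
      exact Real.rpow_le_rpow_of_exponent_le (by exact_mod_cast hn) (by linarith)
  have hlim : Tendsto (fun s => ∑' n, u s n) (𝓝[>] 0) (𝓝 (∑' _ : ℕ, (0 : ℝ))) := by
    refine tendsto_tsum_of_dominated_convergence (hg.add hh) (fun n => ?_) ?_
    · have h0 : Tendsto (fun s : ℝ => s * (residueClass a n / n)) (𝓝[>] 0) (𝓝 0) := by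
        have : Tendsto (fun s : ℝ => s * (residueClass a n / n)) (𝓝 0)
            (𝓝 (0 * (residueClass a n / n))) := tendsto_id.mul_const _
        rw [zero_mul] at this
        exact this.mono_left nhdsWithin_le_nhds
      refine tendsto_of_tendsto_of_tendsto_of_le_of_le' tendsto_const_nhds h0 ?_ ?_
      · filter_upwards [hpos] with s hs
        have := residueClass_nonneg a n
        positivity
      · filter_upwards [hpos] with s hs
        exact mul_le_mul_of_nonneg_left (hdiv s hs n) hs.le
    · filter_upwards [hpos, hle1] with s hs hs1 n
      have hnn := residueClass_nonneg a n
      rw [Real.norm_of_nonneg (by positivity)]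
      by_cases hn : n.Prime
      · simp only [hn, true_and, if_true, zero_div, add_zero]
        by_cases hna : (n : ZMod m) = a
        · have hn0 : (0 : ℝ) < n := mod_cast hn.pos
          have hr : residueClass a n = Real.log n :=
            (Set.indicator_of_mem (s := {n : ℕ | (n : ZMod m) = a}) hna _).trans
              (ArithmeticFunction.vonMangoldt_apply_prime hn)
          rw [if_pos hna, hu]
          simp only
          rw [hr, Real.rpow_add hn0, Real.rpow_one, div_mul_eq_div_div, mul_div_assoc',
            div_le_iff₀ (by positivity), mul_div_assoc']
          rw [one_div]
          -- This makes `1 / p` a dominating function at primes, uniformly in `s`.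
          have h1 : s * Real.log n ≤ (n : ℝ) ^ s := by
            rw [Real.rpow_def_of_pos hn0]
            have := Real.add_one_le_exp (Real.log n * s)
            linarith
          rw [div_eq_inv_mul]
          exact mul_le_mul_of_nonneg_left h1 (by positivity)
        · simp [hu, hna]
      · simp only [hn, false_and, if_false, zero_add]
        calc u s n ≤ 1 * (residueClass a n / n) :=
              mul_le_mul hs1 (hdiv s hs n) (by positivity) zero_le_one
          _ = _ := one_mul _
  rw [tsum_zero] at hlim
  have hlow : Tendsto (fun s : ℝ => (m.totient : ℝ)⁻¹ - C * s) (𝓝[>] 0)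
      (𝓝 ((m.totient : ℝ)⁻¹ - C * 0)) :=
    ((tendsto_id.const_mul C).const_sub _).mono_left nhdsWithin_le_nhds
  have hle := le_of_tendsto_of_tendsto hlow hlim (by
    filter_upwards [hpos, hle1] with s hs hs1
    have h := hC (x := 1 + s) ⟨by linarith, by linarith⟩
    rw [add_sub_cancel_left] at h
    simp only [hu]
    rw [tsum_mul_left]
    calc _ = s * ((m.totient : ℝ)⁻¹ / s - C) := by field_simp
      _ ≤ _ := mul_le_mul_of_nonneg_left h hs.le)
  have : 0 < (m.totient : ℝ)⁻¹ := inv_pos.mpr (mod_cast m.totient.pos_of_neZero)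
  linarith

/-- The residues mod `p ^ 2` at which `A x + B` is not exactly divisible by `p`. -/
theorem exists_residues_prime_sq {p : ℕ} (hp : p.Prime) {A B : ℤ} (hA : ¬ (p : ℤ) ∣ A) :
    ∃ U : Finset (ZMod (p ^ 2)), U.card = p ^ 2 - (p - 1) ∧
      ∀ n : ℕ, ((p : ℤ) ∣ A * n + B → (p : ℤ) ^ 2 ∣ A * n + B) → (n : ZMod (p ^ 2)) ∈ U := by
  classical
  have : NeZero (p ^ 2) := ⟨pow_ne_zero 2 hp.ne_zero⟩
  have hu : IsUnit (A : ZMod (p ^ 2)) := by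
    rw [ZMod.coe_int_isUnit_iff_isCoprime]
    push_cast
    exact ((Nat.prime_iff_prime_int.1 hp).coprime_iff_not_dvd.2 hA).pow_left
  obtain ⟨v, hv⟩ := hu.exists_left_inv
  have hcast : ((p ^ 2 : ℕ) : ℤ) = (p : ℤ) ^ 2 := by push_cast; rfl
  have key : ∀ x c : ZMod (p ^ 2), x = v * (c - (B : ZMod (p ^ 2))) →
      (A : ZMod (p ^ 2)) * x + (B : ZMod (p ^ 2)) = c := by
    rintro x c rfl
    linear_combination (c - (B : ZMod (p ^ 2))) * hv
  -- The excluded residues solve `A x + B ≡ p (k + 1)` modulo `p²` for `0 ≤ k < p - 1`, with `v` the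
  -- inverse of `A`.
  refine ⟨((Finset.range (p - 1)).image
    fun k => v * (((p * (k + 1) : ℕ) : ZMod (p ^ 2)) - B))ᶜ, ?_, fun n hn => ?_⟩
  · rw [Finset.card_compl, ZMod.card, Finset.card_image_of_injOn, Finset.card_range]
    intro k hk l hl hkl
    have h1 := key _ _ (Eq.refl (v * (((p * (k + 1) : ℕ) : ZMod (p ^ 2)) - B)))
    have h2 := key _ _ hkl
    rw [h1] at h2
    have lt : ∀ k ∈ Finset.range (p - 1), p * (k + 1) < p ^ 2 := fun k hk => by
      have := Finset.mem_range.1 hk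
      rw [sq]
      exact Nat.mul_lt_mul_of_pos_left (by omega) hp.pos
    have h3 := (ZMod.natCast_eq_natCast_iff' _ _ _).1 h2
    rw [Nat.mod_eq_of_lt (lt k hk), Nat.mod_eq_of_lt (lt l hl)] at h3
    have := Nat.eq_of_mul_eq_mul_left hp.pos h3
    omega
  · rw [Finset.mem_compl, Finset.mem_image]
    rintro ⟨k, hk, hkn⟩
    have h1 := key _ _ hkn.symm
    have h2 : ((A * n + B : ℤ) : ZMod (p ^ 2)) = ((p * (k + 1) : ℤ) : ZMod (p ^ 2)) := by
      push_cast at h1 ⊢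
      exact h1
    rw [ZMod.intCast_eq_intCast_iff_dvd_sub, hcast] at h2
    have h3 : (p : ℤ) ∣ A * n + B := by
      have := (dvd_sub_right (Dvd.intro (k + 1 : ℤ) rfl)).1 ((dvd_pow_self (p : ℤ) two_ne_zero).trans h2)
      exact this
    have h4 : (p : ℤ) ^ 2 ∣ p * (k + 1) := (dvd_iff_dvd_of_dvd_sub h2).2 (hn h3)
    rw [sq] at h4
    have h5 : p ∣ k + 1 := by
      have := Int.dvd_of_mul_dvd_mul_left (by exact_mod_cast hp.ne_zero) h4
      exact_mod_cast this
    have := Nat.le_of_dvd (Nat.succ_pos k) h5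
    have := Finset.mem_range.1 hk
    omega

/-- Sieving by the squares of finitely many primes. -/
theorem exists_residues_sieve {A B : ℤ} (T : Finset ℕ)
    (hT : ∀ p ∈ T, p.Prime ∧ ¬ (p : ℤ) ∣ A) :
    ∃ (M : ℕ) (W : Finset (ZMod M)), M = ∏ p ∈ T, p ^ 2 ∧
      W.card = ∏ p ∈ T, (p ^ 2 - (p - 1)) ∧
      ∀ n : ℕ, (∀ p ∈ T, (p : ℤ) ∣ A * n + B → (p : ℤ) ^ 2 ∣ A * n + B) → (n : ZMod M) ∈ W := by
  classical
  induction T using Finset.induction_on with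
  | empty => exact ⟨1, {0}, by simp, by simp, fun n _ => by simp [Subsingleton.elim (n : ZMod 1) 0]⟩
  | insert p T hpT ih =>
    obtain ⟨M, W, hM, hW, hmem⟩ := ih fun r hr => hT r (Finset.mem_insert_of_mem hr)
    obtain ⟨hp, hpA⟩ := hT p (Finset.mem_insert_self p T)
    obtain ⟨U, hU, hUmem⟩ := exists_residues_prime_sq (B := B) hp hpA
    have hcop : Nat.Coprime (p ^ 2) M := by
      rw [hM]
      refine Nat.Coprime.prod_right fun r hr => Nat.Coprime.pow 2 2 ?_
      refine (Nat.coprime_primes hp (hT r (Finset.mem_insert_of_mem hr)).1).2 ?_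
      rintro rfl
      exact hpT hr
    refine ⟨p ^ 2 * M, (U ×ˢ W).map (ZMod.chineseRemainder hcop).symm.toEquiv.toEmbedding,
      by rw [Finset.prod_insert hpT, hM], ?_, fun n hn => ?_⟩
    · rw [Finset.card_map, Finset.card_product, Finset.prod_insert hpT, hU, hW]
    · rw [Finset.mem_map_equiv, Finset.mem_product]
      have e : (ZMod.chineseRemainder hcop).symm.toEquiv.symm (n : ZMod (p ^ 2 * M)) =
          ((n : ZMod (p ^ 2)), (n : ZMod M)) := by
        change ZMod.chineseRemainder hcop (n : ZMod (p ^ 2 * M)) = _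
        rw [map_natCast]
        rfl
      rw [e]
      exact ⟨hUmem n (hn p (Finset.mem_insert_self p T)),
        hmem n fun r hr => hn r (Finset.mem_insert_of_mem hr)⟩

theorem card_filter_residues_le {M : ℕ} (hM : 0 < M) (W : Finset (ZMod M)) (N : ℕ)
    (S : Finset ℕ) (hS : ∀ n ∈ S, n < N ∧ (n : ZMod M) ∈ W) : S.card ≤ W.card * (N / M + 1) := by
  classical
  have : NeZero M := ⟨hM.ne'⟩
  have hsub : S ⊆ W.biUnion fun w => (Finset.range N).filter fun n => n ≡ w.val [MOD M] := by
    intro n hn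
    obtain ⟨h1, h2⟩ := hS n hn
    rw [Finset.mem_biUnion]
    refine ⟨_, h2, Finset.mem_filter.2 ⟨Finset.mem_range.2 h1, ?_⟩⟩
    rw [← ZMod.natCast_eq_natCast_iff]
    simp
  refine (Finset.card_le_card hsub).trans (Finset.card_biUnion_le_card_mul _ _ _ fun w _ => ?_)
  rw [← Nat.count_eq_card_filter_range, Nat.count_modEq_card N hM]
  split_ifs <;> omega

/-- Outside `Z`, each prime of the class removes `p - 1` residues modulo `p²`. By the Chinese
remainder theorem the upper density is at most `∏ (1 - (p - 1)/p²) ≤ exp(-½ ∑ 1/p)`, which is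
arbitrarily small. -/
theorem hasNaturalDensity_one_of_sieve {m : ℕ} [NeZero m] {a : ZMod m} (ha : IsUnit a)
    {A B : ℤ} {Z : Set ℕ}
    (hA : ∀ p : ℕ, p.Prime → (p : ZMod m) = a → ¬ (p : ℤ) ∣ A)
    (hZ : ∀ n : ℕ, n ∉ Z → ∀ p : ℕ, p.Prime → (p : ZMod m) = a →
      (p : ℤ) ∣ A * n + B → (p : ℤ) ^ 2 ∣ A * n + B) : HasNaturalDensity Z 1 := by
  classical
  have key : ∀ ε : ℝ, 0 < ε → ∀ᶠ N : ℕ in Filter.atTop,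
      (((Finset.range N).filter fun n => n ∉ Z).card : ℝ) / N < ε := by
    intro ε hε
    have hg0 : ∀ n : ℕ, 0 ≤ if n.Prime ∧ (n : ZMod m) = a then (1 : ℝ) / n else 0 := fun n => by
      split_ifs <;> positivity
    have hdiv := (not_summable_iff_tendsto_nat_atTop_of_nonneg hg0).1
      (not_summable_inv_primes_mod ha)
    -- The bound is chosen so that `exp(-½ ∑ 1/p) ≤ ε / 2`.
    obtain ⟨L, hL⟩ := (hdiv.eventually_ge_atTop (-2 * Real.log (ε / 2))).exists
    set T : Finset ℕ := (Finset.range L).filter fun n : ℕ => n.Prime ∧ (n : ZMod m) = a with hTdef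
    have hT : ∀ p ∈ T, p.Prime ∧ (p : ZMod m) = a := fun p hp => (Finset.mem_filter.1 hp).2
    obtain ⟨M, W, hM, hW, hmem⟩ := exists_residues_sieve (A := A) (B := B) T
      fun p hp => ⟨(hT p hp).1, hA p (hT p hp).1 (hT p hp).2⟩
    have hM0 : 0 < M := by
      rw [hM]
      exact Finset.prod_pos fun p hp => pow_pos (hT p hp).1.pos 2
    have hMr : (0 : ℝ) < M := mod_cast hM0
    have hratio : (W.card : ℝ) / M ≤ ε / 2 := by
      rw [hW, hM]
      push_cast
      rw [← Finset.prod_div_distrib]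
      calc ∏ p ∈ T, (((p ^ 2 - (p - 1) : ℕ) : ℝ) / (p : ℝ) ^ 2)
          ≤ ∏ p ∈ T, Real.exp (-(1 / 2 * (1 / p))) := by
            refine Finset.prod_le_prod (fun p _ => by positivity) fun p hp => ?_
            have h2 : (2 : ℝ) ≤ p := mod_cast (hT p hp).1.two_le
            have h1 := (hT p hp).1.one_le
            have h3 : p - 1 ≤ p ^ 2 := (Nat.sub_le p 1).trans (Nat.le_self_pow two_ne_zero p)
            rw [Nat.cast_sub h3, Nat.cast_sub h1]
            push_cast
            refine le_trans ?_ (Real.add_one_le_exp _)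
            rw [div_le_iff₀ (by positivity)]
            have : (-(1 / 2 * (1 / (p : ℝ))) + 1) * (p : ℝ) ^ 2 = p ^ 2 - p / 2 := by
              field_simp
              ring
            rw [this]
            linarith
        _ = Real.exp (-(1 / 2) * ∑ p ∈ T, (1 / (p : ℝ))) := by
            rw [← Real.exp_sum, Finset.mul_sum]
            congr 1
            exact Finset.sum_congr rfl fun _ _ => by ring
        _ ≤ Real.exp (Real.log (ε / 2)) := by
            rw [← Finset.sum_filter] at hL
            exact Real.exp_le_exp.2 (by linarith)
        _ = ε / 2 := Real.exp_log (by linarith)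
    have hsmall : Filter.Tendsto (fun N : ℕ => (W.card : ℝ) / N) Filter.atTop (nhds 0) :=
      tendsto_const_nhds.div_atTop tendsto_natCast_atTop_atTop
    filter_upwards [hsmall.eventually_lt_const (half_pos hε), Filter.eventually_gt_atTop 0]
      with N hN hN0
    have hNr : (0 : ℝ) < N := mod_cast hN0
    have hcard := card_filter_residues_le hM0 W N ((Finset.range N).filter fun n => n ∉ Z)
      fun n hn => by
        obtain ⟨h1, h2⟩ := Finset.mem_filter.1 hn
        exact ⟨Finset.mem_range.1 h1, hmem n fun p hp => hZ n h2 p (hT p hp).1 (hT p hp).2⟩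
    have hcard' : (((Finset.range N).filter fun n => n ∉ Z).card : ℝ) ≤
        W.card * ((N : ℝ) / M + 1) := by
      refine (Nat.cast_le.2 hcard).trans ?_
      push_cast
      gcongr
      exact Nat.cast_div_le
    calc _ ≤ W.card * ((N : ℝ) / M + 1) / N := by gcongr
      _ = W.card / M + W.card / N := by field_simp
      _ < ε := by linarith
  have hcompl : ∀ N : ℕ, 0 < N → (((Finset.range N).filter fun n => n ∈ Z).card : ℝ) / N =
      1 - (((Finset.range N).filter fun n => n ∉ Z).card : ℝ) / N := fun N hN => by
    have h := Finset.card_filter_add_card_filter_not (s := Finset.range N) (fun n => n ∈ Z)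
    rw [Finset.card_range] at h
    have hN' : (N : ℝ) ≠ 0 := mod_cast hN.ne'
    field_simp
    rw [eq_sub_iff_add_eq]
    exact_mod_cast h
  have hmain : Filter.Tendsto
      (fun N : ℕ => (((Finset.range N).filter fun n => n ∈ Z).card : ℝ) / N)
      Filter.atTop (nhds 1) := by
    rw [Metric.tendsto_nhds]
    intro ε hε
    filter_upwards [key ε hε, Filter.eventually_gt_atTop 0] with N h1 h2
    rw [hcompl N h2, Real.dist_eq, sub_sub_cancel_left, abs_neg, abs_of_nonneg (by positivity)]
    exact h1
  unfold HasNaturalDensity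
  convert hmain

/-- For an inert prime, `u ^ 2 - d v ^ 2` is never exactly divisible by `p`. -/
theorem sq_dvd_of_dvd_norm {p : ℕ} (hp : p.Prime) {d : ℤ} (hd : ¬ IsSquare (d : ZMod p)) {u v : ℤ}
    (h : (p : ℤ) ∣ u ^ 2 - d * v ^ 2) : (p : ℤ) ^ 2 ∣ u ^ 2 - d * v ^ 2 := by
  have := Fact.mk hp
  have h1 : (u : ZMod p) ^ 2 = d * (v : ZMod p) ^ 2 := by
    have := (ZMod.intCast_zmod_eq_zero_iff_dvd _ _).2 h
    push_cast at this
    exact sub_eq_zero.1 this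
  have hv : (v : ZMod p) = 0 := by
    by_contra hv
    exact hd ⟨u / v, by field_simp; exact h1.symm⟩
  have hu : (u : ZMod p) = 0 := by
    rw [hv] at h1
    simpa using h1
  have hu' := (ZMod.intCast_zmod_eq_zero_iff_dvd _ _).1 hu
  have hv' := (ZMod.intCast_zmod_eq_zero_iff_dvd _ _).1 hv
  exact dvd_sub (pow_dvd_pow_of_dvd hu' 2) (Dvd.dvd.mul_left (pow_dvd_pow_of_dvd hv' 2) d)

theorem not_isSquare_two_of_mod_eight {p : ℕ} (hp : p.Prime) (h : (p : ZMod 8) = 3) :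
    ¬ IsSquare (((2 : ℤ)) : ZMod p) := by
  have := Fact.mk hp
  have h8 : p % 8 = 3 := (ZMod.natCast_eq_natCast_iff' p 3 8).1 h
  push_cast
  rw [ZMod.exists_sq_eq_two_iff (by omega)]
  omega

theorem not_isSquare_three_of_mod_twelve {p : ℕ} (hp : p.Prime) (h : (p : ZMod 12) = 5) :
    ¬ IsSquare (((3 : ℤ)) : ZMod p) := by
  have := Fact.mk hp
  have h12 : p % 12 = 5 := (ZMod.natCast_eq_natCast_iff' p 5 12).1 h
  have h2 : ¬ IsSquare (2 : ZMod 3) := by decide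
  have : Fact (Nat.Prime 3) := ⟨Nat.prime_three⟩
  have := ZMod.exists_sq_eq_prime_iff_of_mod_four_eq_one (p := p) (q := 3) (by omega) (by norm_num)
  push_cast at this ⊢
  rw [this]
  have h3 : (p : ZMod 3) = 2 := (ZMod.natCast_eq_natCast_iff' p 2 3).2 (by omega)
  rw [h3]
  exact h2

theorem hasNaturalDensity_of_norm_two (k : ℕ) (s : ℤ) (hs : s ^ 2 = 1) (B : ℤ) {Z : Set ℕ}
    (hZ : ∀ n : ℕ, n ∉ Z → ∃ u v : ℤ, s * 2 ^ k * n + B = u ^ 2 - 2 * v ^ 2) :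
    HasNaturalDensity Z 1 := by
  refine hasNaturalDensity_one_of_sieve (m := 8) (a := 3) (A := s * 2 ^ k) (B := B)
    (IsUnit.of_mul_eq_one 3 (by decide)) (fun p hp h hdvd => ?_) fun n hn p hp h hdvd => ?_
  · have h8 : p % 8 = 3 := (ZMod.natCast_eq_natCast_iff' p 3 8).1 h
    have hp' := Nat.prime_iff_prime_int.1 hp
    rcases hp'.dvd_or_dvd hdvd with h1 | h1
    · exact hp'.not_dvd_one (hs ▸ dvd_pow h1 two_ne_zero)
    · have : p ∣ 2 := by exact_mod_cast hp'.dvd_of_dvd_pow h1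
      have := Nat.le_of_dvd two_pos this
      omega
  · obtain ⟨u, v, huv⟩ := hZ n hn
    rw [huv] at hdvd ⊢
    exact sq_dvd_of_dvd_norm hp (not_isSquare_two_of_mod_eight hp h) hdvd

theorem hasNaturalDensity_of_norm_three (j k : ℕ) (s : ℤ) (hs : s ^ 2 = 1) (B : ℤ) {Z : Set ℕ}
    (hZ : ∀ n : ℕ, n ∉ Z → ∃ u v : ℤ, s * (2 ^ j * 3 ^ k) * n + B = u ^ 2 - 3 * v ^ 2) :
    HasNaturalDensity Z 1 := by
  refine hasNaturalDensity_one_of_sieve (m := 12) (a := 5) (A := s * (2 ^ j * 3 ^ k)) (B := B)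
    (IsUnit.of_mul_eq_one 5 (by decide)) (fun p hp h hdvd => ?_) fun n hn p hp h hdvd => ?_
  · have h12 : p % 12 = 5 := (ZMod.natCast_eq_natCast_iff' p 5 12).1 h
    have hp' := Nat.prime_iff_prime_int.1 hp
    rcases hp'.dvd_or_dvd hdvd with h1 | h1
    · exact hp'.not_dvd_one (hs ▸ dvd_pow h1 two_ne_zero)
    rcases hp'.dvd_or_dvd h1 with h1 | h1
    · have : p ∣ 2 := by exact_mod_cast hp'.dvd_of_dvd_pow h1
      have := Nat.le_of_dvd two_pos this
      omega
    · have : p ∣ 3 := by exact_mod_cast hp'.dvd_of_dvd_pow h1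
      have := Nat.le_of_dvd three_pos this
      omega
  · obtain ⟨u, v, huv⟩ := hZ n hn
    rw [huv] at hdvd ⊢
    exact sq_dvd_of_dvd_norm hp (not_isSquare_three_of_mod_twelve hp h) hdvd

end Density
end QHyper

namespace QHyper

/-! ### Control of the exponents that can occur -/

noncomputable section Support

/-- The power series whose exponents all lie in `E`. -/
def supportedOn (E : Set ℕ) : AddSubgroup ℤ⟦X⟧ where
  carrier := {g | ∀ n ∉ E, PowerSeries.coeff n g = 0}
  zero_mem' := fun n _ => by simp
  add_mem' := fun ha hb n hn => by simp [ha n hn, hb n hn]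
  neg_mem' := fun ha n hn => by simp [ha n hn]

theorem intCast_mul_X_pow_mem {E : Set ℕ} (c : ℤ) {e : ℕ} (he : e ∈ E) :
    (c : ℤ⟦X⟧) * q ^ e ∈ supportedOn E := fun n hn => by
  have : n ≠ e := fun h => hn (h ▸ he)
  rw [← map_intCast (PowerSeries.C (R := ℤ)), PowerSeries.coeff_C_mul, PowerSeries.coeff_X_pow,
    if_neg this, mul_zero]

theorem X_pow_mem {E : Set ℕ} {e : ℕ} (he : e ∈ E) : q ^ e ∈ supportedOn E := by
  have h := intCast_mul_X_pow_mem 1 he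
  rwa [Int.cast_one, one_mul] at h

/-- The coefficient of `q^d` in the infinite sum is already that of the partial sum of length `d +
1`, hence also that of the corresponding partial sum of `A`. -/
theorem summable_and_coeff_tsum {s A : ℕ → ℤ⟦X⟧} {E : Set ℕ} (hs : ∀ n, q ^ n ∣ s n)
    (hsA : ∀ N, q ^ N ∣ ∑ n ∈ Finset.range N, s n - ∑ r ∈ Finset.range N, A r)
    (hA : ∀ r, A r ∈ supportedOn E) :
    Summable s ∧ ∀ n ∉ E, PowerSeries.coeff n (∑' n, s n) = 0 := by
  have hz : ∀ d, ∀ n ∉ Finset.range (d + 1), PowerSeries.coeff d (s n) = 0 := fun d n hn =>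
    PowerSeries.X_pow_dvd_iff.1 (hs n) d (by simpa using hn)
  have hsum : Summable s := (PowerSeries.WithPiTopology.summable_iff_summable_coeff ℤ).2 fun d =>
    summable_of_ne_finset_zero (hz d)
  refine ⟨hsum, fun d hd => ?_⟩
  have h1 := (PowerSeries.WithPiTopology.hasSum_iff_hasSum_coeff ℤ).1 hsum.hasSum d
  rw [h1.unique (hasSum_sum_of_ne_finset_zero (hz d)), ← map_sum]
  have h2 := PowerSeries.X_pow_dvd_iff.1 (hsA (d + 1)) d (Nat.lt_succ_self d)
  rw [map_sub, sub_eq_zero] at h2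
  rw [h2]
  exact AddSubgroup.sum_mem _ (fun r _ => hA r) d hd

theorem kernel_mem_powIdeal {b : ℤ⟦X⟧} (hb : PowerSeries.constantCoeff b = 0) (κ n r : ℕ) :
    kernel (ι b) κ n r ∈ powIdeal 0 := by
  unfold kernel
  split_ifs
  · rw [eulerProd_eq_poch, eulerProd_eq_poch, ← ι_qPoch, ← ι_qPoch, ← map_mul, ← one_div]
    have h1 : (1 : Frac) ∈ powIdeal 0 := by simpa using ι_mem_zero 1
    exact div_mem_powIdeal h1 (by
      rw [map_mul, constantCoeff_qPoch b _ hb, constantCoeff_qPoch b _ hb, mul_one])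
  · exact Submodule.zero_mem _

/-- The common engine for all eight series. The constant `c` normalises the pair, supplying
prefactors such as `q (1 - q)`; only `c α_r`, not `α_r`, has to be a power series. -/
theorem summable_and_coeff_tsum_of_isBaileyPair {b t : ℤ⟦X⟧}
    (hb : PowerSeries.constantCoeff b = 0)
    (ht : PowerSeries.constantCoeff t = 0) {κ : ℕ} {α β : ℕ → Frac}
    (h : IsBaileyPair (ι b) (κ + 1) α β) (c : Frac) (a : ℕ → ℤ⟦X⟧) (hα : ∀ r, c * α r = ι (a r))
    {s A : ℕ → ℤ⟦X⟧} (hs : ∀ n, ι (s n) = c * (weight (ι t) (ι b) (κ + 1) n * β n))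
    (hA : ∀ r, ι (A r) = c * (α r * conjWeight (ι t) (ι b) κ r)) {E : Set ℕ}
    (hE : ∀ r, A r ∈ supportedOn E) :
    Summable s ∧ ∀ n ∉ E, PowerSeries.coeff n (∑' n, s n) = 0 := by
  have hα' : ∀ r, c * α r ∈ powIdeal 0 := fun r => by rw [hα]; exact ι_mem_zero _
  refine summable_and_coeff_tsum (fun n => ?_) (bailey_lemma hb ht h c hα' hs hA) hE
  rw [← ι_mem_powIdeal, hs, h n, ← mul_assoc, mul_comm c, mul_assoc, Finset.mul_sum]
  have hw : weight (ι t) (ι b) (κ + 1) n ∈ powIdeal n := by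
    rw [weight, eulerProd_eq_poch, ← ι_qPoch, ← map_pow]
    exact mul_mem_powIdeal_left _ (shiftProd_mem_powIdeal ht (by simp [hb]) b n)
  have hsum : ∑ r ∈ Finset.range (n + 1), c * (α r * kernel (ι b) (κ + 1) n r) ∈ powIdeal 0 :=
    Submodule.sum_mem _ fun r _ => by
      rw [← mul_assoc]
      simpa using mul_mem_powIdeal (hα' r) (kernel_mem_powIdeal hb (κ + 1) n r)
  simpa using mul_mem_powIdeal hw hsum

end Support

/-! ### Product identities and cleared theta numerators -/

section Products

variable {K : Type*} [Field K]

theorem shiftProd_mul (τ a Q : K) (n : ℕ) : shiftProd τ (τ * a) Q n = τ ^ n * poch a Q n := by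
  induction n with
  | zero => simp
  | succ n ih => rw [shiftProd_succ, ih, poch_succ]; ring

theorem shiftProd_zero_left (Q : K) (k n : ℕ) :
    shiftProd 0 (Q ^ (k + 1)) Q n = (-1) ^ n * Q ^ (tri n + k * n) := by
  induction n with
  | zero => simp
  | succ n ih => rw [shiftProd_succ, ih, tri_succ]; ring

theorem poch_zero_left (Q : K) (n : ℕ) : poch 0 Q n = 1 := by simp [poch]

theorem eulerProd_two_mul (x : K) (n : ℕ) :
    eulerProd x (2 * n) = poch x (x ^ 2) n * eulerProd (x ^ 2) n := by
  induction n with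
  | zero => simp
  | succ n ih =>
    rw [show 2 * (n + 1) = 2 * n + 1 + 1 by ring, eulerProd_succ, eulerProd_succ, ih, poch_succ,
      eulerProd_succ]
    ring

theorem eulerProd_two_mul_add_one (x : K) (n : ℕ) :
    eulerProd x (2 * n + 1) = (1 - x) * poch (x ^ 3) (x ^ 2) n * eulerProd (x ^ 2) n := by
  have h := poch_succ' x (x ^ 2) n
  rw [show x * x ^ 2 = x ^ 3 by ring] at h
  rw [← h, eulerProd_succ, eulerProd_two_mul, poch_succ]
  ring

theorem eulerProd_sq (x : K) (n : ℕ) : eulerProd (x ^ 2) n = eulerProd x n * poch (-x) x n := by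
  induction n with
  | zero => simp
  | succ n ih => rw [eulerProd_succ, eulerProd_succ, ih, poch_succ]; ring

theorem poch_neg (x : K) (n : ℕ) :
    poch (-x) x n = ∏ j ∈ Finset.range n, (1 + x ^ (j + 1)) :=
  Finset.prod_congr rfl fun _ _ => by ring

theorem poch_sq (x : K) (n : ℕ) :
    poch x (x ^ 2) n = ∏ j ∈ Finset.range n, (1 - x ^ (2 * j + 1)) :=
  Finset.prod_congr rfl fun _ _ => by ring

end Products

noncomputable section Numerators

theorem ι_q_ne_zero : ι q ≠ 0 := fun h =>
  PowerSeries.X_ne_zero (ι_injective (h.trans (map_zero ι).symm))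

theorem ι_q_pow_ne_one : ∀ n, ι q ^ (n + 1) ≠ 1 := ι_pow_ne_one (by simp)

theorem ι_q_sq_pow_ne_one : ∀ n, (ι q ^ 2) ^ (n + 1) ≠ 1 := fun n => by
  rw [← pow_mul]; exact ι_q_pow_ne_one (2 * n + 1)

theorem ι_q_pow_ne_neg_one (n : ℕ) : ι q ^ (n + 1) ≠ -1 := fun h => by
  rw [← map_pow, ← map_one ι, ← map_neg] at h
  have := congrArg PowerSeries.constantCoeff (ι_injective h)
  simp at this

theorem ι_hyperbolicSum (g : ℤ⟦X⟧) (r : ℕ) : ι (hyperbolicSum g r) = hyperbolicSum (ι g) r := by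
  simp [hyperbolicSum]

theorem tri_mono : Monotone tri := monotone_nat_of_le_succ fun n => by rw [tri_succ]; omega

/-- `q^{r^2}` times `thetaSq`. -/
def thetaSqNum (r : ℕ) : ℤ⟦X⟧ :=
  ∑ j ∈ Finset.range (r + 1), ((if j = 0 then 1 else 2 * (-1) ^ j : ℤ) : ℤ⟦X⟧) * q ^ (r ^ 2 - j ^ 2)

/-- `q^{r(r+1)/2}` times `thetaTri`. -/
def thetaTriNum (r : ℕ) : ℤ⟦X⟧ :=
  ∑ j ∈ Finset.range (r + 1), (if j = 0 then 1 else 1 + q ^ j) * q ^ (tri r - tri j)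

/-- `q^{r^2+2r}` times `falseTheta`. -/
def falseThetaNum (r : ℕ) : ℤ⟦X⟧ :=
  ∑ j ∈ Finset.range (r + 1),
    (((-1) ^ j : ℤ) : ℤ⟦X⟧) * (1 - q ^ (2 * j + 1)) * q ^ (r ^ 2 + 2 * r - (j ^ 2 + 2 * j))

theorem ι_thetaSqNum (r : ℕ) : ι (thetaSqNum r) = ι q ^ (r ^ 2) * thetaSq (ι q) r := by
  have hx := ι_q_ne_zero
  rw [thetaSqNum, thetaSq, map_sum, Finset.mul_sum]
  refine Finset.sum_congr rfl fun j hj => ?_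
  have hle : j ^ 2 ≤ r ^ 2 := Nat.pow_le_pow_left (Finset.mem_range_succ_iff.1 hj) 2
  obtain ⟨e, he⟩ := Nat.exists_eq_add_of_le hle
  rw [he, Nat.add_sub_cancel_left, map_mul, map_intCast, map_pow, pow_add]
  split_ifs with h
  · simp [h]
  · push_cast
    field_simp

theorem ι_thetaTriNum (r : ℕ) : ι (thetaTriNum r) = ι q ^ tri r * thetaTri (ι q) r := by
  have hx := ι_q_ne_zero
  rw [thetaTriNum, thetaTri, map_sum, Finset.mul_sum]
  refine Finset.sum_congr rfl fun j hj => ?_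
  obtain ⟨e, he⟩ := Nat.exists_eq_add_of_le (tri_mono (Finset.mem_range_succ_iff.1 hj))
  rw [he, Nat.add_sub_cancel_left, map_mul, map_pow, pow_add]
  split_ifs with h
  · simp [h]
  · simp only [map_add, map_one, map_pow]
    field_simp

theorem ι_falseThetaNum (r : ℕ) :
    ι (falseThetaNum r) = ι q ^ (r ^ 2 + 2 * r) * falseTheta (ι q) r := by
  have hx := ι_q_ne_zero
  rw [falseThetaNum, falseTheta, map_sum, Finset.mul_sum]
  refine Finset.sum_congr rfl fun j hj => ?_
  have hj' := Finset.mem_range_succ_iff.1 hj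
  have hle : j ^ 2 + 2 * j ≤ r ^ 2 + 2 * r := by gcongr
  obtain ⟨e, he⟩ := Nat.exists_eq_add_of_le hle
  rw [he, Nat.add_sub_cancel_left, map_mul, map_mul, map_intCast, map_pow, pow_add _ (j ^ 2 + 2 * j)]
  simp only [map_sub, map_one, map_pow]
  push_cast
  field_simp

end Numerators

end QHyper

namespace QHyper

/-! ### The eight series -/

noncomputable section Series

theorem constantCoeff_q_sq : PowerSeries.constantCoeff (q ^ 2) = 0 := by simp

theorem constantCoeff_q : PowerSeries.constantCoeff q = 0 := by simp

/-- Here the parameter `q²` factors as `τ · q` with `τ = q`, so the numerator becomes `q^r (q;q²)_r`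
and cancels all but one factor of the denominator. -/
theorem conjWeight_q_sq_zero (r : ℕ) :
    conjWeight (ι q) (ι (q ^ 2)) 0 r = ι q ^ r / (1 - ι q ^ (2 * r + 1)) := by
  have h1 := eulerProd_ne_zero ι_q_sq_pow_ne_one r
  have h2 := one_sub_ne_zero ι_q_pow_ne_one (2 * r)
  have h3 : poch (ι q) (ι q ^ 2) r ≠ 0 := by
    rw [poch_sq]; exact Finset.prod_ne_zero_iff.2 fun j _ => one_sub_ne_zero ι_q_pow_ne_one _
  have h4 : (ι q ^ 2) ^ (0 + 1) = ι q * ι q := by ring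
  rw [conjWeight, map_pow, h4, shiftProd_mul, poch_succ, add_zero]
  rw [show ι q * (ι q ^ 2) ^ r = ι q ^ (2 * r + 1) by ring]
  field_simp

/-- Now `q⁴ = τ · q³`; the surviving factor `1 - q` is cancelled by the constant `q (1 - q)` used
for `f_4` and `f_8`. -/
theorem conjWeight_q_sq_one (r : ℕ) :
    conjWeight (ι q) (ι (q ^ 2)) 1 r =
      ι q ^ r / ((1 - ι q ^ (2 * r + 2)) * (1 - ι q)) := by
  have h1 := eulerProd_ne_zero ι_q_sq_pow_ne_one r
  have h2 := one_sub_ne_zero ι_q_pow_ne_one (2 * r + 1)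
  have h0 := one_sub_ne_zero ι_q_pow_ne_one 0
  rw [zero_add, pow_one] at h0
  have h3 : poch (ι q ^ 3) (ι q ^ 2) r ≠ 0 := poch_ne_zero (fun n => by
    rw [← pow_mul, ← pow_add, show 3 + 2 * n = 2 + 2 * n + 1 by ring]; exact ι_q_pow_ne_one _) r
  have h4 : (ι q ^ 2) ^ (1 + 1) = ι q * ι q ^ 3 := by ring
  rw [conjWeight, map_pow, h4, shiftProd_mul, poch_succ', eulerProd_succ,
    show ι q * ι q ^ 2 = ι q ^ 3 by ring,
    show (ι q ^ 2) ^ (r + 1) = ι q ^ (2 * r + 1 + 1) by ring]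
  field_simp

theorem conjWeight_zero_zero {b : ℤ⟦X⟧} (hb : PowerSeries.constantCoeff b = 0) (r : ℕ) :
    conjWeight (ι 0) (ι b) 0 r = (-1) ^ r * ι b ^ tri r := by
  have h1 := eulerProd_ne_zero (ι_pow_ne_one hb) r
  rw [conjWeight, map_zero, shiftProd_zero_left, poch_zero_left, add_zero, zero_mul, add_zero]
  field_simp

theorem weight_zero (b : ℤ⟦X⟧) (k n : ℕ) :
    weight (ι 0) (ι b) (k + 1) n = eulerProd (ι b) n * ((-1) ^ n * ι b ^ (tri n + k * n)) := by
  rw [weight, map_zero, shiftProd_zero_left]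

theorem poch_neg_ne_zero (n : ℕ) : poch (-ι q) (ι q) n ≠ 0 := by
  rw [poch_neg]
  exact Finset.prod_ne_zero_iff.2 fun j _ h => ι_q_pow_ne_neg_one j (by linear_combination h)

theorem lacunary_of_coeff {g : ℤ⟦X⟧} {E : Set ℕ} (h : ∀ n ∉ E, PowerSeries.coeff n g = 0)
    (hE : ∀ Z : Set ℕ, (∀ n ∉ Z, n ∈ E) → HasNaturalDensity Z 1) : IsLacunary g :=
  hE _ fun n hn => by
    by_contra hnE
    exact hn (h n hnE)

/-- The exponents `n` for which `A n + B` is of the form `u ^ 2 - d v ^ 2`. -/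
def normSet (d A B : ℤ) : Set ℕ := {n | ∃ u v : ℤ, A * n + B = u ^ 2 - d * v ^ 2}

theorem hyperbolicSum_eq (g : ℤ⟦X⟧) (r : ℕ) :
    hyperbolicSum g r = ∑ i ∈ Finset.range (r + 1), g ^ (i * (r - i)) := rfl

theorem tri_cast (r : ℕ) : (2 : ℤ) * (tri r : ℤ) = (r : ℤ) ^ 2 + r := by
  exact_mod_cast two_mul_tri r

theorem lacunary_term3 : Summable (fun n => term3 n) ∧ IsLacunary (∑' n, term3 n) := by
  obtain ⟨h1, h2⟩ := summable_and_coeff_tsum_of_isBaileyPair (b := q ^ 2) (t := q) (κ := 0)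
    (s := fun n => term3 n) (A := fun r => q ^ (r ^ 2 + 2 * r) * thetaSqNum r)
    (E := normSet 2 (1 * 2 ^ 1) 1) constantCoeff_q_sq constantCoeff_q
    (by rw [map_pow]; exact isBaileyPair_thetaSq ι_q_ne_zero ι_q_pow_ne_one ι_q_pow_ne_neg_one) 1
    (fun r => q ^ (r ^ 2 + r) * (1 - q ^ (2 * r + 1)) * thetaSqNum r)
    (fun r => by
      simp only [map_mul, map_pow, map_sub, map_one, ι_thetaSqNum]
      ring)
    (fun n => by
      have hc := constantCoeff_qPoch (a := -q) q (2 * n + 1) (by simp)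
      simp only [term3]
      rw [map_mul, ι_frac _ hc, weight, ι_qPoch, ι_qPoch, map_neg, map_pow, map_pow,
        poch_neg, ← eulerProd_eq_poch, eulerProd_two_mul,
        show (ι q ^ 2) ^ (0 + 1) = ι q * ι q by ring, shiftProd_mul]
      ring)
    (fun r => by
      have := one_sub_ne_zero ι_q_pow_ne_one (2 * r)
      rw [conjWeight_q_sq_zero]
      simp only [map_mul, map_pow, ι_thetaSqNum]
      field_simp
      ring)
    (fun r => by
      rw [thetaSqNum, Finset.mul_sum]
      refine AddSubgroup.sum_mem _ fun j hj => ?_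
      have hle : j ^ 2 ≤ r ^ 2 := Nat.pow_le_pow_left (Finset.mem_range_succ_iff.1 hj) 2
      obtain ⟨e, he⟩ := Nat.exists_eq_add_of_le hle
      have he' : (r : ℤ) ^ 2 = j ^ 2 + e := mod_cast he
      rw [show r ^ 2 - j ^ 2 = e by omega, mul_left_comm (q ^ (r ^ 2 + 2 * r)), ← pow_add]
      -- The exponent is `n = 2r² + 2r - j²`, so `2n + 1 = (2r + 1)² - 2j²`.
      refine intCast_mul_X_pow_mem _ ⟨2 * r + 1, j, ?_⟩
      push_cast
      linear_combination (-2) * he')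
  exact ⟨h1, lacunary_of_coeff h2 fun Z hZ => hasNaturalDensity_of_norm_two 1 1 rfl 1 hZ⟩

theorem lacunary_term7 : Summable (fun n => term7 n) ∧ IsLacunary (∑' n, term7 n) := by
  obtain ⟨h1, h2⟩ := summable_and_coeff_tsum_of_isBaileyPair (b := q ^ 2) (t := 0) (κ := 0)
    (s := fun n => term7 n)
    (A := fun r => (-1) ^ r * q ^ (2 * r ^ 2 + 2 * r) * (1 - q ^ (2 * r + 1)) * thetaSqNum r)
    (E := normSet 3 (1 * (2 ^ 0 * 3 ^ 1)) 1) constantCoeff_q_sq (by simp)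
    (by rw [map_pow]; exact isBaileyPair_thetaSq ι_q_ne_zero ι_q_pow_ne_one ι_q_pow_ne_neg_one) 1
    (fun r => q ^ (r ^ 2 + r) * (1 - q ^ (2 * r + 1)) * thetaSqNum r)
    (fun r => by
      simp only [map_mul, map_pow, map_sub, map_one, ι_thetaSqNum]
      ring)
    (fun n => by
      have hc := constantCoeff_qPoch (a := -q) q (2 * n + 1) (by simp)
      have ht : (ι q ^ 2) ^ tri n = ι q ^ (n ^ 2 + n) := by rw [← pow_mul, two_mul_tri]
      simp only [term7]
      rw [map_mul, ι_frac _ hc, weight_zero, map_mul, ι_qPoch, ι_qPoch, map_neg, map_pow ι q 2,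
        map_pow ι q (n ^ 2 + n), poch_neg, ← eulerProd_eq_poch, zero_mul, add_zero, ht]
      simp only [map_pow, map_neg, map_one]
      ring)
    (fun r => by
      have ht : (ι q ^ 2) ^ tri r = ι q ^ (r ^ 2 + r) := by rw [← pow_mul, two_mul_tri]
      rw [conjWeight_zero_zero constantCoeff_q_sq, map_pow ι q, ht]
      simp only [map_mul, map_pow, map_neg, map_one, map_sub, ι_thetaSqNum]
      ring)
    (fun r => by
      rw [thetaSqNum, Finset.mul_sum]
      refine AddSubgroup.sum_mem _ fun j hj => ?_
      have hle : j ^ 2 ≤ r ^ 2 := Nat.pow_le_pow_left (Finset.mem_range_succ_iff.1 hj) 2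
      obtain ⟨e, he⟩ := Nat.exists_eq_add_of_le hle
      have he' : (r : ℤ) ^ 2 = j ^ 2 + e := mod_cast he
      rw [show r ^ 2 - j ^ 2 = e by omega]
      set c : ℤ := if j = 0 then 1 else 2 * (-1) ^ j
      rw [show (-1) ^ r * q ^ (2 * r ^ 2 + 2 * r) * (1 - q ^ (2 * r + 1)) * ((c : ℤ⟦X⟧) * q ^ e) =
        (((-1) ^ r * c : ℤ) : ℤ⟦X⟧) * q ^ (2 * r ^ 2 + 2 * r + e) -
          (((-1) ^ r * c : ℤ) : ℤ⟦X⟧) * q ^ (2 * r ^ 2 + 2 * r + e + (2 * r + 1)) by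
        push_cast; ring]
      -- Completing the square in `n = 3r² + 2r - j²` and in `n = 3r² + 4r + 1 - j²`.
      refine AddSubgroup.sub_mem _ (intCast_mul_X_pow_mem _ ⟨3 * r + 1, j, ?_⟩)
        (intCast_mul_X_pow_mem _ ⟨3 * r + 2, j, ?_⟩) <;>
      · push_cast
        linear_combination (-3) * he')
  exact ⟨h1, lacunary_of_coeff h2 fun Z hZ => hasNaturalDensity_of_norm_three 0 1 1 rfl 1 hZ⟩

theorem lacunary_term5 : Summable (fun n => term5 n) ∧ IsLacunary (∑' n, term5 n) := by
  obtain ⟨h1, h2⟩ := summable_and_coeff_tsum_of_isBaileyPair (b := q) (t := 0) (κ := 0)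
    (s := fun n => term5 n) (A := fun r => q ^ (2 * tri r) * thetaTriNum r)
    (E := normSet 3 (-1 * (2 ^ 3 * 3 ^ 0)) (-2)) constantCoeff_q (by simp)
    (isBaileyPair_thetaTri ι_q_ne_zero ι_q_pow_ne_one) 1
    (fun r => (-1) ^ r * q ^ tri r * thetaTriNum r)
    (fun r => by
      simp only [map_mul, map_pow, map_neg, map_one, ι_thetaTriNum]
      ring)
    (fun n => by
      have hc := constantCoeff_qPoch (a := q) (q ^ 2) (n + 1) (by simp)
      simp only [term5]
      rw [map_mul, map_mul, ι_frac _ hc, weight_zero, ι_qPoch, ι_qPoch, map_pow ι q,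
        poch_sq, ← eulerProd_eq_poch, zero_mul, add_zero, ← tri]
      simp only [map_pow, map_neg, map_one]
      ring)
    (fun r => by
      rw [conjWeight_zero_zero constantCoeff_q]
      simp only [map_mul, map_pow, ι_thetaTriNum]
      have hs : ((-1) ^ r * (-1) ^ r : Frac) = 1 := by rw [← mul_pow]; simp
      linear_combination (-(ι q ^ (3 * tri r) * thetaTri (ι q) r)) * hs)
    (fun r => by
      rw [thetaTriNum, Finset.mul_sum]
      refine AddSubgroup.sum_mem _ fun j hj => ?_
      obtain ⟨e, he⟩ := Nat.exists_eq_add_of_le (tri_mono (Finset.mem_range_succ_iff.1 hj))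
      have he' : (tri r : ℤ) = tri j + e := mod_cast he
      rw [show tri r - tri j = e by omega, mul_left_comm (q ^ (2 * tri r)), ← pow_add]
      have m1 : q ^ (2 * tri r + e) ∈ supportedOn (normSet 3 (-1 * (2 ^ 3 * 3 ^ 0)) (-2)) := by
        refine X_pow_mem ⟨2 * j + 1, 2 * r + 1, ?_⟩
        push_cast
        linear_combination (-12) * tri_cast r + 4 * tri_cast j + 8 * he'
      have m2 : q ^ (2 * tri r + e + j) ∈ supportedOn (normSet 3 (-1 * (2 ^ 3 * 3 ^ 0)) (-2)) := by
        -- Adding `j` to the exponent replaces `j(j+1)/2` by `j(j-1)/2`, hence `2j + 1` by `2j - 1`.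
        refine X_pow_mem ⟨2 * j - 1, 2 * r + 1, ?_⟩
        push_cast
        linear_combination (-12) * tri_cast r + 4 * tri_cast j + 8 * he'
      split_ifs
      · rwa [one_mul]
      · rw [add_mul, one_mul, ← pow_add, add_comm j]
        exact AddSubgroup.add_mem _ m1 m2)
  exact ⟨h1, lacunary_of_coeff h2 fun Z hZ => hasNaturalDensity_of_norm_three 3 0 (-1) rfl (-2) hZ⟩

theorem lacunary_term4 : Summable (fun n => term4 n) ∧ IsLacunary (∑' n, term4 n) := by
  have h0 := one_sub_ne_zero ι_q_pow_ne_one 0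
  rw [zero_add, pow_one] at h0
  obtain ⟨h1, h2⟩ := summable_and_coeff_tsum_of_isBaileyPair (b := q ^ 2) (t := q) (κ := 1)
    (s := fun n => term4 n) (A := fun r => q ^ (r ^ 2 + 2 * r + 1) * falseThetaNum r)
    (E := normSet 2 (-1 * 2 ^ 0) 0) constantCoeff_q_sq constantCoeff_q
    (by rw [map_pow]; exact isBaileyPair_falseTheta ι_q_ne_zero ι_q_pow_ne_one ι_q_pow_ne_neg_one)
    (ι (q * (1 - q)))
    (fun r => q * (1 - q) * q ^ (r ^ 2 + r) * (1 - q ^ (2 * r + 2)) * falseThetaNum r)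
    (fun r => by
      simp only [map_mul, map_pow, map_sub, map_one, ι_falseThetaNum]
      ring)
    (fun n => by
      have hc := constantCoeff_qPoch (a := -q) q (2 * n + 2) (by simp)
      simp only [term4]
      rw [map_mul, ι_frac _ hc, weight, ι_qPoch, ι_qPoch, map_neg, map_pow, map_pow,
        poch_neg, ← eulerProd_eq_poch, eulerProd_two_mul_add_one,
        show (ι q ^ 2) ^ (1 + 1) = ι q * ι q ^ 3 by ring, shiftProd_mul]
      simp only [map_mul, map_sub, map_one]
      ring)
    (fun r => by
      have := one_sub_ne_zero ι_q_pow_ne_one (2 * r + 1)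
      rw [conjWeight_q_sq_one]
      simp only [map_mul, map_pow, map_sub, map_one, ι_falseThetaNum]
      field_simp
      ring)
    (fun r => by
      rw [falseThetaNum, Finset.mul_sum]
      refine AddSubgroup.sum_mem _ fun j hj => ?_
      have hj' := Finset.mem_range_succ_iff.1 hj
      have hle : j ^ 2 + 2 * j ≤ r ^ 2 + 2 * r := by gcongr
      obtain ⟨e, he⟩ := Nat.exists_eq_add_of_le hle
      have he' : (r : ℤ) ^ 2 + 2 * r = j ^ 2 + 2 * j + e := mod_cast he
      rw [show r ^ 2 + 2 * r - (j ^ 2 + 2 * j) = e by omega]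
      set c : ℤ := (-1) ^ j
      rw [show q ^ (r ^ 2 + 2 * r + 1) * ((c : ℤ⟦X⟧) * (1 - q ^ (2 * j + 1)) * q ^ e) =
        (c : ℤ⟦X⟧) * q ^ (r ^ 2 + 2 * r + 1 + e) -
          (c : ℤ⟦X⟧) * q ^ (r ^ 2 + 2 * r + 1 + e + (2 * j + 1)) by ring]
      -- The exponents are `2(r+1)² - (j+1)²` and `2(r+1)² - j²`.
      refine AddSubgroup.sub_mem _ (intCast_mul_X_pow_mem _ ⟨j + 1, r + 1, ?_⟩)
        (intCast_mul_X_pow_mem _ ⟨j, r + 1, ?_⟩) <;>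
      · push_cast
        linear_combination he')
  exact ⟨h1, lacunary_of_coeff h2 fun Z hZ => hasNaturalDensity_of_norm_two 0 (-1) rfl 0 hZ⟩

theorem lacunary_term6 :
    Summable (fun n => term6 (n + 1)) ∧ IsLacunary (∑' n, term6 (n + 1)) := by
  -- With `τ = -q` the parameter `q²` is `(-q)(-q)`, so the weight is `(q)_n (-q)_n (-q)^n = (-q)^n
  -- (q²;q²)_n`.
  obtain ⟨h1, h2⟩ := summable_and_coeff_tsum_of_isBaileyPair (b := q) (t := -q) (κ := 1)
    (s := fun n => term6 (n + 1)) (A := fun r => -(q ^ (r + 1 + tri r) * hyperbolicSum q r))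
    (E := normSet 3 (-1 * (2 ^ 2 * 3 ^ 0)) 1) constantCoeff_q (by simp)
    (isBaileyPair_hyperbolicSum ι_q_ne_zero ι_q_pow_ne_one) (ι (-q))
    (fun r => -q * ((1 - q ^ (2 * r + 2)) * (-1) ^ r * q ^ tri r * hyperbolicSum q r))
    (fun r => by
      simp only [map_mul, map_pow, map_sub, map_neg, map_one, ι_hyperbolicSum])
    (fun n => by
      have hc := constantCoeff_qPoch (a := q) q (2 * n + 1) (by simp)
      simp only [term6]
      rw [show 2 * (n + 1) - 1 = 2 * n + 1 by omega, Nat.add_sub_cancel, map_mul, map_mul,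
        ι_frac _ hc, weight, map_mul, ι_qPoch, ι_qPoch, ι_qPoch, map_neg, map_pow ι q,
        ← eulerProd_eq_poch, ← eulerProd_eq_poch, ← eulerProd_eq_poch, eulerProd_sq,
        show ι q ^ (1 + 1) = -ι q * -ι q by ring, shiftProd_mul]
      simp only [map_pow, map_neg, map_one]
      rw [show (-ι q) ^ n = (-1) ^ n * ι q ^ n by rw [← mul_pow]; ring]
      ring)
    (fun r => by
      have h3 := one_sub_ne_zero ι_q_pow_ne_one r
      have h4 : 1 + ι q ^ (r + 1) ≠ 0 := fun h => ι_q_pow_ne_neg_one r (by linear_combination h)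
      have h5 := poch_neg_ne_zero r
      have h6 := eulerProd_ne_zero ι_q_pow_ne_one r
      rw [conjWeight, map_neg ι q, show ι q ^ (1 + 1) = -ι q * -ι q by ring, shiftProd_mul,
        poch_succ, eulerProd_succ, show 1 - -ι q * ι q ^ r = 1 + ι q ^ (r + 1) by ring,
        show (-ι q) ^ r = (-1) ^ r * ι q ^ r by rw [← mul_pow]; ring,
        show 1 - ι q ^ (2 * r + 2) = (1 - ι q ^ (r + 1)) * (1 + ι q ^ (r + 1)) by ring]
      simp only [map_mul, map_pow, map_neg, ι_hyperbolicSum]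
      have hs : ((-1) ^ r * (-1) ^ r : Frac) = 1 := by rw [← mul_pow]; simp
      field_simp
      linear_combination (ι q ^ (r + 1 + tri r) * hyperbolicSum (ι q) r) * hs)
    (fun r => by
      rw [hyperbolicSum_eq, Finset.mul_sum]
      refine AddSubgroup.neg_mem _ (AddSubgroup.sum_mem _ fun i hi => ?_)
      obtain ⟨m, rfl⟩ := Nat.exists_eq_add_of_le (Finset.mem_range_succ_iff.1 hi)
      rw [Nat.add_sub_cancel_left, ← pow_add]
      -- The form is diagonalised by `4im = (i + m)² - (i - m)²`; the same substitution serves every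
      -- `hyperbolicSum` series.
      refine X_pow_mem ⟨i - m, i + m + 1, ?_⟩
      have ht := tri_cast (i + m)
      push_cast at ht ⊢
      linear_combination (-2) * ht)
  exact ⟨h1, lacunary_of_coeff h2 fun Z hZ => hasNaturalDensity_of_norm_three 2 0 (-1) rfl 1 hZ⟩

theorem lacunary_term8 :
    Summable (fun n => term8 (n + 1)) ∧ IsLacunary (∑' n, term8 (n + 1)) := by
  have h0 := one_sub_ne_zero ι_q_pow_ne_one 0
  rw [zero_add, pow_one] at h0
  obtain ⟨h1, h2⟩ := summable_and_coeff_tsum_of_isBaileyPair (b := q ^ 2) (t := q) (κ := 1)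
    (s := fun n => term8 (n + 1))
    (A := fun r => (-1) ^ r * (1 + q ^ (2 * r + 2)) * q ^ (r + 1 + 2 * tri r) *
      hyperbolicSum (q ^ 2) r)
    (E := normSet 3 (1 * (2 ^ 1 * 3 ^ 1)) (-2)) constantCoeff_q_sq constantCoeff_q
    (by
      rw [map_pow]
      exact isBaileyPair_hyperbolicSum (pow_ne_zero 2 ι_q_ne_zero) ι_q_sq_pow_ne_one)
    (ι (q * (1 - q)))
    (fun r => q * (1 - q) * ((1 - (q ^ 2) ^ (2 * r + 2)) * (-1) ^ r * (q ^ 2) ^ tri r *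
      hyperbolicSum (q ^ 2) r))
    (fun r => by
      simp only [map_mul, map_pow, map_sub, map_neg, map_one, ι_hyperbolicSum])
    (fun n => by
      have hc := constantCoeff_qPoch (a := q ^ (2 * (n + 1))) (q ^ 2) (n + 1) (by simp)
      have h3 := eulerProd_ne_zero ι_q_sq_pow_ne_one n
      have h4 := eulerProd_ne_zero ι_q_sq_pow_ne_one (2 * n + 1)
      simp only [term8]
      rw [show 2 * (n + 1) - 1 = 2 * n + 1 by omega, map_mul, ι_frac _ hc, weight, ι_qPoch,
        ι_qPoch, map_pow ι q 2, map_pow, map_pow, ← eulerProd_eq_poch, pow_mul (ι q) 2 (n + 1),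
        show (ι q ^ 2) ^ (1 + 1) = ι q * ι q ^ 3 by ring, shiftProd_mul,
        eulerProd_two_mul_add_one]
      rw [show 2 * n + 1 = n + (n + 1) by ring, eulerProd_add] at h4 ⊢
      have h5 := right_ne_zero_of_mul h4
      simp only [map_mul, map_sub, map_one]
      field_simp
      ring)
    (fun r => by
      have := one_sub_ne_zero ι_q_pow_ne_one (2 * r + 1)
      rw [conjWeight_q_sq_one]
      simp only [map_mul, map_pow, map_sub, map_add, map_neg, map_one, ι_hyperbolicSum]
      field_simp
      ring)
    (fun r => by
      rw [hyperbolicSum_eq, Finset.mul_sum]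
      refine AddSubgroup.sum_mem _ fun i hi => ?_
      obtain ⟨m, rfl⟩ := Nat.exists_eq_add_of_le (Finset.mem_range_succ_iff.1 hi)
      rw [Nat.add_sub_cancel_left]
      have ht := tri_cast (i + m)
      push_cast at ht
      rw [show ((-1) ^ (i + m) * (1 + q ^ (2 * (i + m) + 2)) * q ^ (i + m + 1 + 2 * tri (i + m)) *
          (q ^ 2) ^ (i * m) : ℤ⟦X⟧) =
        (((-1) ^ (i + m) : ℤ) : ℤ⟦X⟧) * q ^ (i + m + 1 + 2 * tri (i + m) + 2 * (i * m)) +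
        (((-1) ^ (i + m) : ℤ) : ℤ⟦X⟧) *
          q ^ (i + m + 1 + 2 * tri (i + m) + 2 * (i * m) + (2 * (i + m) + 2)) by
        push_cast; ring]
      refine AddSubgroup.add_mem _ (intCast_mul_X_pow_mem _ ⟨3 * (i + m) + 2, i - m, ?_⟩)
        (intCast_mul_X_pow_mem _ ⟨3 * (i + m) + 4, i - m, ?_⟩) <;>
      · push_cast
        linear_combination 6 * ht)
  exact ⟨h1, lacunary_of_coeff h2 fun Z hZ => hasNaturalDensity_of_norm_three 1 1 1 rfl (-2) hZ⟩

theorem lacunary_term2 :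
    Summable (fun n => term2 (n + 1)) ∧ IsLacunary (∑' n, term2 (n + 1)) := by
  obtain ⟨h1, h2⟩ := summable_and_coeff_tsum_of_isBaileyPair (b := q) (t := 0) (κ := 1)
    (s := fun n => term2 (n + 1))
    (A := fun r => (1 + q ^ (r + 1)) * q ^ (tri r + r + 1) * hyperbolicSum (q ^ 2) r)
    (E := normSet 2 (1 * 2 ^ 4) (-7)) constantCoeff_q (by simp)
    (isBaileyPair_hyperbolicSum_sq ι_q_ne_zero ι_q_pow_ne_one) (ι q)
    (fun r => q * ((1 - q ^ (2 * r + 2)) * (-1) ^ r * hyperbolicSum (q ^ 2) r))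
    (fun r => by
      simp only [map_mul, map_pow, map_sub, map_neg, map_one, ι_hyperbolicSum])
    (fun n => by
      have hc : PowerSeries.constantCoeff (qPoch (-q) q n * qPoch q q (2 * n + 1)) = 1 := by
        rw [map_mul, constantCoeff_qPoch q _ (by simp), constantCoeff_qPoch q _ (by simp), mul_one]
      have h3 := eulerProd_ne_zero ι_q_pow_ne_one n
      have h4 := eulerProd_ne_zero ι_q_pow_ne_one (2 * n)
      have h5 := poch_neg_ne_zero n
      have h6 := one_sub_ne_zero ι_q_pow_ne_one (2 * n)
      have hs : ((-1) ^ n * (-1) ^ n : Frac) = 1 := by rw [← mul_pow]; simp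
      simp only [term2]
      rw [show 2 * (n + 1) - 1 = 2 * n + 1 by omega, show 2 * (n + 1) - 2 = 2 * n by omega,
        Nat.add_sub_cancel, ι_frac _ hc, weight_zero, ← tri, tri_succ]
      rw [map_mul, map_mul, ι_qPoch, ι_qPoch, ι_qPoch, map_neg, map_pow,
        ← eulerProd_eq_poch, ← eulerProd_eq_poch, eulerProd_sq, eulerProd_succ]
      field_simp
      linear_combination (-(ι q ^ (tri n + (n + 1)))) * hs)
    (fun r => by
      have h3 := one_sub_ne_zero ι_q_pow_ne_one r
      have h6 := eulerProd_ne_zero ι_q_pow_ne_one r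
      have hs : ((-1) ^ r * (-1) ^ r : Frac) = 1 := by rw [← mul_pow]; simp
      rw [conjWeight, map_zero ι, shiftProd_zero_left, poch_zero_left, eulerProd_succ,
        show 1 - ι q ^ (2 * r + 2) = (1 - ι q ^ (r + 1)) * (1 + ι q ^ (r + 1)) by ring]
      simp only [map_mul, map_pow, map_add, map_one, ι_hyperbolicSum]
      field_simp
      linear_combination (-(ι q ^ (tri r + r + 1) * (1 + ι q ^ (r + 1)) *
        hyperbolicSum (ι q ^ 2) r)) * hs)
    (fun r => by
      rw [hyperbolicSum_eq, Finset.mul_sum]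
      refine AddSubgroup.sum_mem _ fun i hi => ?_
      obtain ⟨m, rfl⟩ := Nat.exists_eq_add_of_le (Finset.mem_range_succ_iff.1 hi)
      rw [Nat.add_sub_cancel_left]
      have ht := tri_cast (i + m)
      push_cast at ht
      rw [show ((1 + q ^ (i + m + 1)) * q ^ (tri (i + m) + (i + m) + 1) *
          (q ^ 2) ^ (i * m) : ℤ⟦X⟧) =
        ((1 : ℤ) : ℤ⟦X⟧) * q ^ (tri (i + m) + (i + m) + 1 + 2 * (i * m)) +
        ((1 : ℤ) : ℤ⟦X⟧) * q ^ (tri (i + m) + (i + m) + 1 + 2 * (i * m) + (i + m + 1)) by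
        push_cast; ring]
      refine AddSubgroup.add_mem _ (intCast_mul_X_pow_mem _ ⟨4 * (i + m) + 3, 2 * (i - m), ?_⟩)
        (intCast_mul_X_pow_mem _ ⟨4 * (i + m) + 5, 2 * (i - m), ?_⟩) <;>
      · push_cast
        linear_combination 8 * ht)
  exact ⟨h1, lacunary_of_coeff h2 fun Z hZ => hasNaturalDensity_of_norm_two 4 1 rfl (-7) hZ⟩

/-- The `β` of `f_2` is used again, now relative to `a = q`. The change of parameter makes `α_r` a
difference of two terms, and `key` and `key'` treat their exponents separately. -/
theorem lacunary_term1 : Summable (fun n => term1 n) ∧ IsLacunary (∑' n, term1 n) := by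
  have hpair := isBaileyPair_hyperbolicSum_sq ι_q_ne_zero ι_q_pow_ne_one
  simp only [mul_assoc] at hpair
  have key : ∀ r i m : ℕ, r = i + m → q ^ (tri r) * (q ^ 2) ^ (i * m) ∈
      supportedOn (normSet 2 (1 * 2 ^ 4) 1) := by
    rintro r i m rfl
    have ht := tri_cast (i + m)
    push_cast at ht
    rw [← pow_mul, ← pow_add]
    refine X_pow_mem ⟨4 * (i + m) + 1, 2 * (i - m), ?_⟩
    push_cast
    linear_combination 8 * ht
  have key' : ∀ r i m : ℕ, r = i + m → q ^ (tri (r + 1) + 2 * (r + 1)) * (q ^ 2) ^ (i * m) ∈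
      supportedOn (normSet 2 (1 * 2 ^ 4) 1) := by
    rintro r i m rfl
    have ht := tri_cast (i + m)
    push_cast at ht
    rw [← pow_mul, ← pow_add, tri_succ]
    refine X_pow_mem ⟨4 * (i + m) + 7, 2 * (i - m), ?_⟩
    push_cast
    linear_combination 8 * ht
  obtain ⟨h1, h2⟩ := summable_and_coeff_tsum_of_isBaileyPair (b := q) (t := 0) (κ := 0)
    (s := fun n => term1 n)
    (A := fun r => q ^ tri r * hyperbolicSum (q ^ 2) r +
      if r = 0 then 0 else q ^ (tri r + 2 * r) * hyperbolicSum (q ^ 2) (r - 1))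
    (E := normSet 2 (1 * 2 ^ 4) 1) constantCoeff_q (by simp)
    (isBaileyPair_one_of_two ι_q_ne_zero ι_q_pow_ne_one hpair) 1
    (fun r => (-1) ^ r * hyperbolicSum (q ^ 2) r -
      if r = 0 then 0 else q ^ (2 * r) * ((-1) ^ (r - 1) * hyperbolicSum (q ^ 2) (r - 1)))
    (fun r => by
      rw [one_mul]
      split_ifs <;>
      simp only [map_mul, map_pow, map_sub, map_neg, map_one, map_zero, ι_hyperbolicSum])
    (fun n => by
      have hc : PowerSeries.constantCoeff (qPoch (-q) q n * qPoch q q (2 * n + 1)) = 1 := by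
        rw [map_mul, constantCoeff_qPoch q _ (by simp), constantCoeff_qPoch q _ (by simp), mul_one]
      have h3 := eulerProd_ne_zero ι_q_pow_ne_one n
      have h4 := eulerProd_ne_zero ι_q_pow_ne_one (2 * n)
      have h5 := poch_neg_ne_zero n
      have h6 := one_sub_ne_zero ι_q_pow_ne_one (2 * n)
      have hs : ((-1) ^ n * (-1) ^ n : Frac) = 1 := by rw [← mul_pow]; simp
      simp only [term1]
      rw [ι_frac _ hc, weight_zero, ← tri, map_mul, map_mul, ι_qPoch, ι_qPoch, ι_qPoch, map_neg,
        map_pow, ← eulerProd_eq_poch, ← eulerProd_eq_poch, eulerProd_sq, eulerProd_succ]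
      rw [zero_mul, add_zero]
      field_simp
      linear_combination -hs)
    (fun r => by
      rw [conjWeight_zero_zero constantCoeff_q]
      rcases r with _ | r
      · simp [hyperbolicSum]
      · have hs : ((-1) ^ r * (-1) ^ r : Frac) = 1 := by rw [← mul_pow]; simp
        rw [if_neg (Nat.succ_ne_zero r), if_neg (Nat.succ_ne_zero r), Nat.add_sub_cancel]
        simp only [map_add, map_mul, map_pow, ι_hyperbolicSum]
        linear_combination (-(ι q ^ tri (r + 1) * hyperbolicSum (ι q ^ 2) (r + 1) +
          ι q ^ (tri (r + 1) + 2 * (r + 1)) * hyperbolicSum (ι q ^ 2) r)) * hs)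
    (fun r => by
      refine AddSubgroup.add_mem _ ?_ ?_
      · rw [hyperbolicSum_eq, Finset.mul_sum]
        refine AddSubgroup.sum_mem _ fun i hi => key _ _ _ ?_
        have := Finset.mem_range_succ_iff.1 hi
        omega
      · rcases r with _ | r
        · simp
        · rw [if_neg (Nat.succ_ne_zero r), Nat.add_sub_cancel, hyperbolicSum_eq, Finset.mul_sum]
          refine AddSubgroup.sum_mem _ fun i hi => key' _ _ _ ?_
          have := Finset.mem_range_succ_iff.1 hi
          omega)
  exact ⟨h1, lacunary_of_coeff h2 fun Z hZ => hasNaturalDensity_of_norm_two 4 1 rfl 1 hZ⟩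

end Series

end QHyper

theorem corollary1 :
    ∀ i : Fin 8, Summable (QHyper.summand i) ∧ QHyper.IsLacunary (QHyper.f i) := by
  intro i
  fin_cases i
  · exact QHyper.lacunary_term1
  · exact QHyper.lacunary_term2
  · exact QHyper.lacunary_term3
  · exact QHyper.lacunary_term4
  · exact QHyper.lacunary_term5
  · exact QHyper.lacunary_term6
  · exact QHyper.lacunary_term7
  · exact QHyper.lacunary_term8
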